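/- For a unital C$^*$-algebra $K$ let $\mathbb H_+(K)=\{T\in K:\ \mathrm{Im}\,T\ge \epsilon 1\text{ for some }\epsilon>0\}$, and for a C$^*$-subalgebra $1\in A\subset K$ let $\Delta_+\mathfrak M_n(A)$ be the set of lower triangular matrices in $\mathfrak M_n(A)$ whose diagonal entries lie in $\mathbb H_+(A)$. An element $X\in K$ is algebraically free from $A$ if evaluation at $X$ is injective on the algebra $A\langle t\rangle$ of noncommutative polynomials in $t$ with coefficients in $A$ (the free product of $A$ and $\mathbb C[t]$). Let $A\langle X\rangle$ be the algebra generated by $A$ and $X$; if $X$ is algebraically free from $A$, let $\partial_{X:A}:A\langle X\rangle\to A\langle X\rangle\otimes A\langle X\rangle$ be the free difference quotient, i.e. the derivation with $\partial_{X:A}(a)=0$ for $a\in A$ and $\partial_{X:A}(X)=1\otimes 1$. It is called closable if it is closable in norm as a densely defined operator into the minimal C$^*$-tensor product of $K$ with itself. Let $K$ and $L$ be unital C$^*$-algebras, and $1\in A\subset K$, $1\in B\subset L$ C$^*$-subalgebras. Let $X=X^*\in K$ be algebraically free from $A$ and $Y=Y^*\in L$ algebraically free from $B$. Suppose $\Psi:L\to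 K$ is a unital completely positive linear map such that $\Psi(B\langle Y\rangle)\subset A\langle X\rangle$ and $$(\Psi\otimes\Psi)\circ\partial_{Y:B}=\partial_{X:A}\circ\Psi|_{B\langle Y\rangle}.$$ Suppose also that $\partial_{X:A}$ and $\partial_{Y:B}$ are closable. Then for every $n$ there is a holomorphic map $\Phi_n:\Delta_+\mathfrak M_n(B)\to\Delta_+\mathfrak M_n(A)$ (where $\Delta_+\mathfrak M_n(B)$ is regarded as an open subset of the Banach space of lower triangular matrices over $B$) such that, for every $\beta\in\Delta_+\mathfrak M_n(B)$, the matrices $Y\otimes I_n-\beta$ and $X\otimes I_n-\Phi_n(\beta)$ are invertible and $$\mathfrak M_n(\Psi)\big((Y\otimes I_n-\beta)^{-1}\big)=(X\otimes I_n-\Phi_n(\beta))^{-1}.$$ -/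

import Mathlib

open scoped TensorProduct

universe u

noncomputable section

/-! ### Noncommutative polynomials with coefficients in an algebra -/

/-- The relations identifying the letters `some a`, `a ∈ A`, of a free algebra with the elements
of the algebra `A`; the remaining letter `none` is the indeterminate `t`. -/
inductive NCPoly.Rel (A : Type u) [Ring A] [Algebra ℂ A] :
    FreeAlgebra ℂ (Option A) → FreeAlgebra ℂ (Option A) → Prop
  | add (a b : A) : NCPoly.Rel A (FreeAlgebra.ι ℂ (some (a + b)))
      (FreeAlgebra.ι ℂ (some a) + FreeAlgebra.ι ℂ (some b))
  | mul (a b : A) : NCPoly.Rel A (FreeAlgebra.ι ℂ (some (a * b)))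
      (FreeAlgebra.ι ℂ (some a) * FreeAlgebra.ι ℂ (some b))
  | scalar (r : ℂ) : NCPoly.Rel A (FreeAlgebra.ι ℂ (some (algebraMap ℂ A r)))
      (algebraMap ℂ (FreeAlgebra ℂ (Option A)) r)

/-- `A⟨t⟩`: noncommutative polynomials in one indeterminate `t` with coefficients in `A`, i.e. the
free product (coproduct of unital complex algebras) of `A` and `ℂ[t]`. The coefficients do not
commute with `t`. -/
abbrev NCPoly (A : Type u) [Ring A] [Algebra ℂ A] : Type u := RingQuot (NCPoly.Rel A)

namespace NCPoly

variable {A : Type u} [Ring A] [Algebra ℂ A]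

/-- The inclusion `A → A⟨t⟩` of the coefficients. -/
def C : A →ₐ[ℂ] NCPoly A where
  toFun a := RingQuot.mkAlgHom ℂ (Rel A) (FreeAlgebra.ι ℂ (some a))
  map_add' a b := by
    rw [RingQuot.mkAlgHom_rel ℂ (Rel.add a b), map_add]
  map_mul' a b := by
    rw [RingQuot.mkAlgHom_rel ℂ (Rel.mul a b), map_mul]
  commutes' r := by
    rw [RingQuot.mkAlgHom_rel ℂ (Rel.scalar r), AlgHom.commutes]
  map_one' := by
    have h := RingQuot.mkAlgHom_rel ℂ (Rel.scalar (A := A) 1)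
    simpa using h
  map_zero' := by
    have h := RingQuot.mkAlgHom_rel ℂ (Rel.scalar (A := A) 0)
    simpa using h

/-- The indeterminate `t ∈ A⟨t⟩`. -/
def t : NCPoly A := RingQuot.mkAlgHom ℂ (Rel A) (FreeAlgebra.ι ℂ none)

/-- The universal property of `A⟨t⟩`: a unital homomorphism `f : A → S` and an element `x ∈ S`
determine the homomorphism `A⟨t⟩ → S` with `a ↦ f a` and `t ↦ x`. -/
def lift {S : Type*} [Ring S] [Algebra ℂ S] (f : A →ₐ[ℂ] S) (x : S) : NCPoly A →ₐ[ℂ] S :=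
  RingQuot.liftAlgHom ℂ ⟨FreeAlgebra.lift ℂ (fun o : Option A => o.elim x f), by
    rintro _ _ (⟨a, b⟩ | ⟨a, b⟩ | ⟨r⟩) <;> simp⟩

@[simp] theorem lift_C {S : Type*} [Ring S] [Algebra ℂ S] (f : A →ₐ[ℂ] S) (x : S) (a : A) :
    lift f x (C a) = f a := by
  simp [lift, C]

@[simp] theorem lift_t {S : Type*} [Ring S] [Algebra ℂ S] (f : A →ₐ[ℂ] S) (x : S) :
    lift f x (t : NCPoly A) = x := by
  simp [lift, t]

/-- Two homomorphisms on `A⟨t⟩` that agree on the coefficients and on `t` are equal. -/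
theorem hom_ext {S : Type*} [Ring S] [Algebra ℂ S] {f g : NCPoly A →ₐ[ℂ] S}
    (hC : ∀ a, f (C a) = g (C a)) (ht : f t = g t) : f = g := by
  refine RingQuot.ringQuot_ext' ℂ f g (FreeAlgebra.hom_ext ?_)
  funext o
  cases o with
  | none => exact ht
  | some a => exact hC a

/-- `a ↦ diag(a ⊗ 1, 1 ⊗ a)`. -/
def diagHom : A →ₐ[ℂ] Matrix (Fin 2) (Fin 2) (NCPoly A ⊗[ℂ] NCPoly A) where
  toFun a := !![C a ⊗ₜ[ℂ] 1, 0; 0, 1 ⊗ₜ[ℂ] C a]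
  map_one' := by
    ext i j
    fin_cases i <;> fin_cases j <;> simp [Algebra.TensorProduct.one_def]
  map_mul' a b := by
    ext i j
    fin_cases i <;> fin_cases j <;> simp [Matrix.mul_apply]
  map_zero' := by
    ext i j
    fin_cases i <;> fin_cases j <;> simp
  map_add' a b := by
    ext i j
    fin_cases i <;> fin_cases j <;> simp [TensorProduct.add_tmul, TensorProduct.tmul_add]
  commutes' r := by
    ext i j
    fin_cases i <;> fin_cases j <;>
      simp [Matrix.algebraMap_matrix_apply, Algebra.algebraMap_eq_smul_one,
        TensorProduct.smul_tmul, Algebra.TensorProduct.one_def]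

/-- The homomorphism `P ↦ (P ⊗ 1, ∂P; 0, 1 ⊗ P)` into upper triangular matrices, whose corner is
the free difference quotient `∂`. -/
def triHom : NCPoly A →ₐ[ℂ] Matrix (Fin 2) (Fin 2) (NCPoly A ⊗[ℂ] NCPoly A) :=
  lift diagHom !![t ⊗ₜ[ℂ] 1, 1; 0, 1 ⊗ₜ[ℂ] t]

/-- The free difference quotient `∂ : A⟨t⟩ → A⟨t⟩ ⊗ A⟨t⟩`: the derivation that sends `A` to `0`
and `t` to `1 ⊗ 1`; see `diffQuot_C`, `diffQuot_t` and `diffQuot_mul`. -/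
def diffQuot : NCPoly A →ₗ[ℂ] NCPoly A ⊗[ℂ] NCPoly A :=
  (Matrix.entryLinearMap ℂ (NCPoly A ⊗[ℂ] NCPoly A) (0 : Fin 2) (1 : Fin 2)) ∘ₗ
    triHom.toLinearMap

theorem diffQuot_C (a : A) : diffQuot (C a) = 0 := by
  simp [diffQuot, triHom, diagHom]

theorem diffQuot_t : diffQuot (t : NCPoly A) = 1 ⊗ₜ[ℂ] 1 := by
  simp [diffQuot, triHom, Algebra.TensorProduct.one_def]

theorem triHom_diag (P : NCPoly A) :
    triHom P 1 0 = 0 ∧ triHom P 0 0 = P ⊗ₜ[ℂ] 1 ∧ triHom P 1 1 = 1 ⊗ₜ[ℂ] P := by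
  obtain ⟨w, rfl⟩ := RingQuot.mkAlgHom_surjective ℂ (Rel A) P
  induction w using FreeAlgebra.induction with
  | grade0 r =>
    rw [AlgHom.commutes, AlgHom.commutes]
    simp [Matrix.algebraMap_matrix_apply, Algebra.algebraMap_eq_smul_one,
      TensorProduct.smul_tmul, Algebra.TensorProduct.one_def]
  | grade1 o =>
    cases o with
    | none =>
      change triHom t 1 0 = 0 ∧ triHom t 0 0 = t ⊗ₜ[ℂ] 1 ∧ triHom t 1 1 = 1 ⊗ₜ[ℂ] t
      simp [triHom]
    | some a =>
      change triHom (C a) 1 0 = 0 ∧ triHom (C a) 0 0 = C a ⊗ₜ[ℂ] 1 ∧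
        triHom (C a) 1 1 = 1 ⊗ₜ[ℂ] C a
      simp [triHom, diagHom]
  | mul x y hx hy =>
    obtain ⟨x1, x2, x3⟩ := hx
    obtain ⟨y1, y2, y3⟩ := hy
    simp [map_mul, Matrix.mul_apply, x1, x2, x3, y1, y2, y3]
  | add x y hx hy =>
    obtain ⟨x1, x2, x3⟩ := hx
    obtain ⟨y1, y2, y3⟩ := hy
    simp [map_add, x1, x2, x3, y1, y2, y3, TensorProduct.add_tmul, TensorProduct.tmul_add]

/-- The Leibniz rule `∂(PQ) = P · ∂Q + ∂P · Q`, with the bimodule structure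
`P · (U ⊗ V) · Q = PU ⊗ VQ`. -/
theorem diffQuot_mul (P Q : NCPoly A) :
    diffQuot (P * Q) = (P ⊗ₜ[ℂ] 1) * diffQuot Q + diffQuot P * (1 ⊗ₜ[ℂ] Q) := by
  simp [diffQuot, map_mul, Matrix.mul_apply, triHom_diag]

end NCPoly

/-! ### Algebraic freeness and the free difference quotient in a C⋆-algebra -/

section DiffQuot

variable {K : Type u} [CStarAlgebra K]

/-- Evaluation `A⟨t⟩ → K`, `f ↦ f(X)`, for a subalgebra `A ⊆ K` and `X ∈ K`. -/
def evalAt (A : StarSubalgebra ℂ K) (X : K) : NCPoly A →ₐ[ℂ] K :=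
  NCPoly.lift A.toSubalgebra.val X

/-- `A⟨X⟩`: the (algebraic) subalgebra of `K` generated by `A` and `X`. -/
def genAlg (A : StarSubalgebra ℂ K) (X : K) : Subalgebra ℂ K := (evalAt A X).range

theorem genAlg_eq_adjoin (A : StarSubalgebra ℂ K) (X : K) :
    genAlg A X = Algebra.adjoin ℂ ((A : Set K) ∪ {X}) := by
  apply le_antisymm
  · rintro _ ⟨P, rfl⟩
    obtain ⟨w, rfl⟩ := RingQuot.mkAlgHom_surjective ℂ (NCPoly.Rel A) P
    change evalAt A X _ ∈ _
    induction w using FreeAlgebra.induction with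
    | grade0 r =>
      rw [AlgHom.commutes, AlgHom.commutes]
      exact Subalgebra.algebraMap_mem _ r
    | grade1 o =>
      cases o with
      | none =>
        change evalAt A X NCPoly.t ∈ _
        rw [evalAt, NCPoly.lift_t]
        exact Algebra.subset_adjoin (Or.inr rfl)
      | some a =>
        change evalAt A X (NCPoly.C a) ∈ _
        rw [evalAt, NCPoly.lift_C]
        exact Algebra.subset_adjoin (Or.inl a.2)
    | mul x y hx hy =>
      rw [map_mul, map_mul]
      exact mul_mem hx hy
    | add x y hx hy =>
      rw [map_add, map_add]
      exact add_mem hx hy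
  · rw [Algebra.adjoin_le_iff]
    rintro x (hx | hx)
    · exact ⟨NCPoly.C ⟨x, hx⟩, NCPoly.lift_C _ _ _⟩
    · rw [Set.mem_singleton_iff] at hx
      subst hx
      exact ⟨NCPoly.t, NCPoly.lift_t _ _⟩

/-- `X` is algebraically free from `A`: no nonzero noncommutative polynomial with coefficients in
`A` vanishes at `X`. -/
def AlgFree (A : StarSubalgebra ℂ K) (X : K) : Prop := Function.Injective (evalAt A X)

/-- For `X` algebraically free from `A`, evaluation is an isomorphism `A⟨t⟩ ≃ A⟨X⟩`. -/
def evalEquiv {A : StarSubalgebra ℂ K} {X : K} (h : AlgFree A X) : NCPoly A ≃ₐ[ℂ] genAlg A X :=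
  AlgEquiv.ofInjective (evalAt A X) h

/-- The free difference quotient `∂_{X:A} : A⟨X⟩ → A⟨X⟩ ⊗ A⟨X⟩`: the derivation that sends `A` to
`0` and `X` to `1 ⊗ 1`; see `freeDiffQuot_coe`, `freeDiffQuot_self` and `freeDiffQuot_mul`. -/
def freeDiffQuot {A : StarSubalgebra ℂ K} {X : K} (h : AlgFree A X) :
    genAlg A X →ₗ[ℂ] genAlg A X ⊗[ℂ] genAlg A X :=
  TensorProduct.map (evalEquiv h).toLinearMap (evalEquiv h).toLinearMap ∘ₗ
    NCPoly.diffQuot ∘ₗ (evalEquiv h).symm.toLinearMap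

theorem freeDiffQuot_coe {A : StarSubalgebra ℂ K} {X : K} (h : AlgFree A X) (a : K) (ha : a ∈ A)
    (ha' : a ∈ genAlg A X) : freeDiffQuot h ⟨a, ha'⟩ = 0 := by
  have : (⟨a, ha'⟩ : genAlg A X) = evalEquiv h (NCPoly.C ⟨a, ha⟩) :=
    Subtype.ext (NCPoly.lift_C A.toSubalgebra.val X ⟨a, ha⟩).symm
  rw [this]
  simp [freeDiffQuot, NCPoly.diffQuot_C]

theorem freeDiffQuot_self {A : StarSubalgebra ℂ K} {X : K} (h : AlgFree A X)
    (hX : X ∈ genAlg A X) : freeDiffQuot h ⟨X, hX⟩ = 1 ⊗ₜ[ℂ] 1 := by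
  have : (⟨X, hX⟩ : genAlg A X) = evalEquiv h NCPoly.t :=
    Subtype.ext (NCPoly.lift_t A.toSubalgebra.val X).symm
  rw [this]
  simp [freeDiffQuot, NCPoly.diffQuot_t]

theorem freeDiffQuot_mul {A : StarSubalgebra ℂ K} {X : K} (h : AlgFree A X)
    (P Q : genAlg A X) : freeDiffQuot h (P * Q) =
      (P ⊗ₜ[ℂ] 1) * freeDiffQuot h Q + freeDiffQuot h P * (1 ⊗ₜ[ℂ] Q) := by
  have key : ∀ U V : NCPoly A ⊗[ℂ] NCPoly A,
      TensorProduct.map (evalEquiv h).toLinearMap (evalEquiv h).toLinearMap (U * V) =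
        TensorProduct.map (evalEquiv h).toLinearMap (evalEquiv h).toLinearMap U *
          TensorProduct.map (evalEquiv h).toLinearMap (evalEquiv h).toLinearMap V :=
    fun U V => map_mul
      (Algebra.TensorProduct.map (evalEquiv h).toAlgHom (evalEquiv h).toAlgHom) U V
  simp [freeDiffQuot, NCPoly.diffQuot_mul, key]

end DiffQuot

/-! ### The minimal C⋆-norm and closability -/

section Spatial

variable {K : Type u} [CStarAlgebra K]

/-- `π₁ ⊗ π₂ : K ⊗ K → B(H₁ ⊗ H₂)` for representations `π₁, π₂` of `K` on `H₁, H₂`. Here `H₁ ⊗ H₂`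
is the algebraic tensor product with its Hilbert space inner product; bounded operators on it have
the same norm as their extensions to the completion. -/
def repTensor {H₁ H₂ : Type*} [NormedAddCommGroup H₁] [InnerProductSpace ℂ H₁] [CompleteSpace H₁]
    [NormedAddCommGroup H₂] [InnerProductSpace ℂ H₂] [CompleteSpace H₂]
    (π₁ : K →⋆ₐ[ℂ] (H₁ →L[ℂ] H₁)) (π₂ : K →⋆ₐ[ℂ] (H₂ →L[ℂ] H₂)) :
    K ⊗[ℂ] K →ₗ[ℂ] (H₁ ⊗[ℂ] H₂ →L[ℂ] H₁ ⊗[ℂ] H₂) :=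
  TensorProduct.lift <| LinearMap.mk₂ ℂ (fun a b => TensorProduct.mapL (π₁ a) (π₂ b))
    (fun a a' b => by rw [map_add, TensorProduct.mapL_add_left])
    (fun c a b => by rw [map_smul, TensorProduct.mapL_smul_left])
    (fun a b b' => by rw [map_add, TensorProduct.mapL_add_right])
    (fun c a b => by rw [map_smul, TensorProduct.mapL_smul_right])

/-- The values `‖(π₁ ⊗ π₂)(u)‖`, over all pairs of representations of `K` on Hilbert spaces. -/
def repNorms (w : K ⊗[ℂ] K) : Set ℝ :=
  {r | ∃ (H₁ H₂ : Type u) (_ : NormedAddCommGroup H₁) (_ : InnerProductSpace ℂ H₁)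
    (_ : CompleteSpace H₁) (_ : NormedAddCommGroup H₂) (_ : InnerProductSpace ℂ H₂)
    (_ : CompleteSpace H₂) (π₁ : K →⋆ₐ[ℂ] (H₁ →L[ℂ] H₁)) (π₂ : K →⋆ₐ[ℂ] (H₂ →L[ℂ] H₂)),
    r = ‖repTensor π₁ π₂ w‖}

theorem bddAbove_repNorms (w : K ⊗[ℂ] K) : BddAbove (repNorms w) := by
  induction w using TensorProduct.induction_on with
  | zero =>
    refine ⟨0, ?_⟩
    rintro _ ⟨H₁, H₂, _, _, _, _, _, _, π₁, π₂, rfl⟩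
    rw [map_zero]
    exact (ContinuousLinearMap.opNorm_zero).le
  | tmul a b =>
    refine ⟨‖a‖ * ‖b‖, ?_⟩
    rintro _ ⟨H₁, H₂, _, _, _, _, _, _, π₁, π₂, rfl⟩
    have h : repTensor π₁ π₂ (a ⊗ₜ[ℂ] b) = TensorProduct.mapL (π₁ a) (π₂ b) := rfl
    rw [h]
    refine (TensorProduct.norm_mapL_le _ _).trans ?_
    exact mul_le_mul (NonUnitalStarAlgHom.norm_apply_le π₁ a)
      (NonUnitalStarAlgHom.norm_apply_le π₂ b) (norm_nonneg _) (norm_nonneg _)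
  | add x y hx hy =>
    obtain ⟨c, hc⟩ := hx
    obtain ⟨d, hd⟩ := hy
    refine ⟨c + d, ?_⟩
    rintro _ ⟨H₁, H₂, _, _, _, _, _, _, π₁, π₂, rfl⟩
    rw [map_add]
    have h₁ : ‖repTensor π₁ π₂ x‖ ≤ c := hc ⟨H₁, H₂, _, _, _, _, _, _, π₁, π₂, rfl⟩
    have h₂ : ‖repTensor π₁ π₂ y‖ ≤ d := hd ⟨H₁, H₂, _, _, _, _, _, _, π₁, π₂, rfl⟩
    exact (ContinuousLinearMap.opNorm_add_le _ _).trans (add_le_add h₁ h₂)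

/-- The minimal (spatial) C⋆-norm on the algebraic tensor product `K ⊗ K`. -/
def spatialNorm (w : K ⊗[ℂ] K) : ℝ := sSup (repNorms w)

/-- `∂_{X:A}` viewed as a map `A⟨X⟩ → K ⊗ K`. -/
def freeDiffQuotAmbient {A : StarSubalgebra ℂ K} {X : K} (h : AlgFree A X) :
    genAlg A X →ₗ[ℂ] K ⊗[ℂ] K :=
  TensorProduct.map (genAlg A X).val.toLinearMap (genAlg A X).val.toLinearMap ∘ₗ freeDiffQuot h

/-- `∂_{X:A}` is closable, as a densely defined operator from the norm closure of `A⟨X⟩` in `K` to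
the minimal C⋆-tensor product of `K` with itself: if `P_k → 0` and `∂P_k` converges in the
completion of `K ⊗ K` (i.e. is Cauchy), then its limit is `0`. -/
def ClosableDiffQuot {A : StarSubalgebra ℂ K} {X : K} (h : AlgFree A X) : Prop :=
  ∀ P : ℕ → genAlg A X,
    Filter.Tendsto (fun k => (P k : K)) Filter.atTop (nhds 0) →
    (∀ ε : ℝ, 0 < ε → ∃ N : ℕ, ∀ k ≥ N, ∀ l ≥ N,
      spatialNorm (freeDiffQuotAmbient h (P k) - freeDiffQuotAmbient h (P l)) < ε) →
    Filter.Tendsto (fun k => spatialNorm (freeDiffQuotAmbient h (P k))) Filter.atTop (nhds 0)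

end Spatial

/-! ### Half-planes and lower triangular matrices -/

/-- The upper half-plane `ℍ₊(K) = {T ∈ K | Im T ≥ ε 1 for some ε > 0}`. -/
def upperHalf (K : Type u) [CStarAlgebra K] [PartialOrder K] [StarOrderedRing K] : Set K :=
  {T | ∃ ε : ℝ, 0 < ε ∧ algebraMap ℝ K ε ≤ (imaginaryPart T : K)}

/-- `Δ₊M_n(A)` for a C⋆-subalgebra `1 ∈ A ⊆ K`: lower triangular `n × n` matrices over `A` with
diagonal entries in the upper half-plane (an element of `A` lies in the upper half-plane of `A` if
and only if it lies in that of `K`). -/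
def deltaPlus {K : Type u} [CStarAlgebra K] [PartialOrder K] [StarOrderedRing K]
    (A : StarSubalgebra ℂ K) (n : ℕ) : Set (Matrix (Fin n) (Fin n) A) :=
  {κ | (∀ i j, i < j → κ i j = 0) ∧ ∀ i, (κ i i : K) ∈ upperHalf K}

end

/-! The equation leaves no choice: `Φ β` must be `X ⊗ I - κ⁻¹`, where `κ` is the image under `Ψ` of
the resolvent `(Y ⊗ I - β)⁻¹`. Three things have to be checked.

Half-planes. Addition of a self-adjoint element, `T ↦ -T⁻¹` and unital positive maps all preserve
the upper half-plane. For lower triangular matrices only the diagonal entries matter, and the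
diagonal of an inverse is the inverse of the diagonal. Hence every inverse exists and `Φ β` is again
in `triangularHalf` (`subordination_mem`).

Entries in `A`. This is where the difference quotient enters (`subordination_apply_mem`). Resolvents
need not be polynomials, so `Y` is replaced by `zY` and everything is expanded in powers of `z`: the
coefficients of `p = (zY - β)⁻¹` lie in `B⟨Y⟩`. Leibniz gives `∂p = -z p ⊗ p`
(`mapCoeff_formal_resolvent`); since `Ψ` intertwines the difference quotients, `q = Ψ(p)` satisfies
the same equation (`mapCoeff_map_formal_resolvent`). Conversely this equation gives `∂(q⁻¹) = z`
(`mapCoeff_inverse_of_corepresentation`), so `∂(zX - q⁻¹) = 0`. The kernel of `∂` is `A`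
(`mem_of_freeDiffQuot_eq_zero`), so all Taylor coefficients at `0` of the corresponding curve lie in
`M_n(A)`. As `zY` is self-adjoint for real `z`, the curve is real-analytic on the whole line; the
identity theorem modulo the closed subspace `M_n(A)` takes this to `z = 1`
(`mem_of_iteratedDeriv_mem`).

Holomorphy. The map into `M_n(K)` is built from inversions and bounded linear maps, and
differentiability descends along the isometric inclusion of `A` in `K`. -/

noncomputable section

/-! ### The kernel of the free difference quotient -/

namespace NCPoly

variable {A : Type u} [Ring A] [Algebra ℂ A]

theorem induction_on {p : NCPoly A → Prop} (P : NCPoly A) (hC : ∀ a, p (C a)) (ht : p t)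
    (hadd : ∀ P Q, p P → p Q → p (P + Q)) (hmul : ∀ P Q, p P → p Q → p (P * Q)) : p P := by
  obtain ⟨w, rfl⟩ := RingQuot.mkAlgHom_surjective ℂ (Rel A) P
  induction w using FreeAlgebra.induction with
  | grade0 r =>
    rw [AlgHom.commutes, ← AlgHom.commutes (C : A →ₐ[ℂ] NCPoly A)]
    exact hC _
  | grade1 o =>
    cases o with
    | none => exact ht
    | some a => exact hC a
  | mul x y hx hy => rw [map_mul]; exact hmul _ _ hx hy
  | add x y hx hy => rw [map_add]; exact hadd _ _ hx hy

/-- The homomorphism `A⟨t⟩ → A⟨t⟩[s]` that is the identity on `A` and sends `t` to `s t`. -/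
def scaleHom : NCPoly A →ₐ[ℂ] Polynomial (NCPoly A) :=
  lift (Polynomial.CAlgHom.comp C) (Polynomial.X * Polynomial.C t)

/-- The linear map `U ⊗ V ↦ U(st) t V(st)`. -/
def insertScaled : NCPoly A ⊗[ℂ] NCPoly A →ₗ[ℂ] Polynomial (NCPoly A) :=
  LinearMap.mul' ℂ _ ∘ₗ TensorProduct.map
    (LinearMap.mulRight ℂ (Polynomial.C t) ∘ₗ scaleHom.toLinearMap) scaleHom.toLinearMap

theorem insertScaled_tmul (P Q : NCPoly A) :
    insertScaled (P ⊗ₜ[ℂ] Q) = scaleHom P * Polynomial.C t * scaleHom Q := by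
  simp [insertScaled]

theorem insertScaled_left_mul (P : NCPoly A) (w : NCPoly A ⊗[ℂ] NCPoly A) :
    insertScaled ((P ⊗ₜ[ℂ] 1) * w) = scaleHom P * insertScaled w := by
  induction w using TensorProduct.induction_on with
  | zero => simp
  | tmul a b => simp [insertScaled_tmul, mul_assoc]
  | add x y hx hy => rw [mul_add, map_add, map_add, hx, hy, mul_add]

theorem insertScaled_right_mul (Q : NCPoly A) (w : NCPoly A ⊗[ℂ] NCPoly A) :
    insertScaled (w * (1 ⊗ₜ[ℂ] Q)) = insertScaled w * scaleHom Q := by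
  induction w using TensorProduct.induction_on with
  | zero => simp
  | tmul a b => simp [insertScaled_tmul, mul_assoc]
  | add x y hx hy => rw [add_mul, map_add, map_add, hx, hy, add_mul]

/-- Chain rule: both sides are derivations along `scaleHom` that vanish on `A` and send `t` to `t`.
It turns `∂P = 0` into a statement about an ordinary polynomial in the central variable `s`. -/
theorem derivative_scaleHom (P : NCPoly A) :
    Polynomial.derivative (scaleHom P) = insertScaled (diffQuot P) := by
  induction P using induction_on with
  | hC a => simp [scaleHom, diffQuot_C]
  | ht => simp [scaleHom, diffQuot_t, insertScaled_tmul]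
  | hadd P Q hP hQ => simp [hP, hQ]
  | hmul P Q hP hQ =>
    rw [map_mul, Polynomial.derivative_mul, hP, hQ, diffQuot_mul, map_add,
      insertScaled_left_mul, insertScaled_right_mul, add_comm]

theorem eval_one_scaleHom (P : NCPoly A) :
    Polynomial.eval₂RingHom' (RingHom.id (NCPoly A)) 1 (fun _ => Commute.one_right _)
      (scaleHom P) = P := by
  induction P using induction_on with
  | hC a => simp [scaleHom, Polynomial.eval₂RingHom']
  | ht =>
    rw [scaleHom, lift_t, map_mul]
    simp [Polynomial.eval₂RingHom']
  | hadd P Q hP hQ => rw [map_add, map_add, hP, hQ]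
  | hmul P Q hP hQ => rw [map_mul, map_mul, hP, hQ]

theorem constantCoeff_scaleHom (P : NCPoly A) :
    Polynomial.constantCoeff (scaleHom P) ∈ (C : A →ₐ[ℂ] NCPoly A).range := by
  induction P using induction_on with
  | hC a => simp [scaleHom]
  | ht => simp [scaleHom]
  | hadd P Q hP hQ => rw [map_add, map_add]; exact add_mem hP hQ
  | hmul P Q hP hQ => rw [map_mul, map_mul]; exact mul_mem hP hQ

/-- If `∂P = 0` then `P(st)` has zero derivative in `s`, so it is constant in `s`; its values at `s
= 1` and `s = 0` are `P` and an element of `A`. -/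
theorem mem_range_C_of_diffQuot_eq_zero {P : NCPoly A} (hP : diffQuot P = 0) :
    ∃ a, C a = P := by
  have h0 : Polynomial.derivative (scaleHom P) = 0 := by rw [derivative_scaleHom, hP, map_zero]
  -- Characteristic zero is what makes a polynomial with zero derivative constant.
  have : IsAddTorsionFree (NCPoly A) := by
    have : Module ℚ (NCPoly A) := Module.compHom _ (algebraMap ℚ ℂ)
    exact IsAddTorsionFree.of_module_rat _
  have h1 := Polynomial.eq_C_of_natDegree_eq_zero
    (Polynomial.derivative_eq_zero.1 h0)
  obtain ⟨a, ha⟩ := constantCoeff_scaleHom P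
  refine ⟨a, ?_⟩
  have h2 := eval_one_scaleHom P
  rw [h1] at h2
  have h3 : (scaleHom P).coeff 0 = C a := ha.symm
  rw [h3] at h2
  simpa [Polynomial.eval₂RingHom'] using h2

end NCPoly

theorem mem_of_freeDiffQuot_eq_zero {K : Type u} [CStarAlgebra K] {A : StarSubalgebra ℂ K} {X : K}
    (h : AlgFree A X) {P : genAlg A X} (hP : freeDiffQuot h P = 0) : (P : K) ∈ A := by
  have h1 : NCPoly.diffQuot ((evalEquiv h).symm P) = 0 := by
    have hinj : Function.Injective
        (TensorProduct.map (evalEquiv h).toLinearMap (evalEquiv h).toLinearMap) :=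
      (TensorProduct.congr (evalEquiv h).toLinearEquiv (evalEquiv h).toLinearEquiv).injective
    apply hinj
    rw [map_zero]
    exact hP
  obtain ⟨a, ha⟩ := NCPoly.mem_range_C_of_diffQuot_eq_zero h1
  have h2 : P = evalEquiv h (NCPoly.C a) := by rw [ha, AlgEquiv.apply_symm_apply]
  have h3 : (P : K) = a := by
    rw [h2]
    exact NCPoly.lift_C _ _ _
  rw [h3]
  exact a.2

/-! ### Formal resolvents and the corepresentation equation -/

section FormalResolvent

open PowerSeries

variable {R S : Type*} [Ring R] [Algebra ℂ R] [Ring S] [Algebra ℂ S]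
  {m : Type*} [Fintype m] [DecidableEq m]

/-- The entrywise and coefficientwise action of a linear map on power series of matrices. -/
def mapCoeff (f : R →ₗ[ℂ] S) (F : (Matrix m m R)⟦X⟧) : (Matrix m m S)⟦X⟧ :=
  PowerSeries.mk fun k => (coeff k F).map f

@[simp] theorem coeff_mapCoeff (f : R →ₗ[ℂ] S) (F : (Matrix m m R)⟦X⟧) (k : ℕ) :
    coeff k (mapCoeff f F) = (coeff k F).map f := by
  simp [mapCoeff]

theorem mapCoeff_X_mul (f : R →ₗ[ℂ] S) (F : (Matrix m m R)⟦X⟧) :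
    mapCoeff f (X * F) = X * mapCoeff f F := by
  ext k i j
  cases k with
  | zero => simp
  | succ k => simp [coeff_succ_X_mul]

theorem mapCoeff_neg (f : R →ₗ[ℂ] S) (F : (Matrix m m R)⟦X⟧) :
    mapCoeff f (-F) = -mapCoeff f F := by
  ext k i j
  simp

theorem mapCoeff_sub (f : R →ₗ[ℂ] S) (F G : (Matrix m m R)⟦X⟧) :
    mapCoeff f (F - G) = mapCoeff f F - mapCoeff f G := by
  ext k i j
  simp

theorem mapCoeff_one {f : R →ₗ[ℂ] S} (h1 : f 1 = 0) :
    mapCoeff f (1 : (Matrix m m R)⟦X⟧) = 0 := by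
  ext k i j
  rw [coeff_mapCoeff, coeff_one]
  split_ifs <;> simp [Matrix.one_apply]
  split_ifs <;> simp [h1]

theorem mapCoeff_C (f : R →ₗ[ℂ] S) (M : Matrix m m R) :
    mapCoeff f (C M) = C (M.map f) := by
  ext k i j
  rw [coeff_mapCoeff, coeff_C, coeff_C]
  split_ifs <;> simp

/-- The coefficientwise map `F ↦ F ⊗ 1`. -/
def inclLeft : (Matrix m m R)⟦X⟧ →+* (Matrix m m (R ⊗[ℂ] R))⟦X⟧ :=
  PowerSeries.map (Algebra.TensorProduct.includeLeft : R →ₐ[ℂ] R ⊗[ℂ] R).mapMatrix.toRingHom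

/-- The coefficientwise map `F ↦ 1 ⊗ F`. -/
def inclRight : (Matrix m m R)⟦X⟧ →+* (Matrix m m (R ⊗[ℂ] R))⟦X⟧ :=
  PowerSeries.map (Algebra.TensorProduct.includeRight : R →ₐ[ℂ] R ⊗[ℂ] R).mapMatrix.toRingHom

theorem coeff_inclLeft (F : (Matrix m m R)⟦X⟧) (k : ℕ) (i j : m) :
    coeff k (inclLeft F) i j = coeff k F i j ⊗ₜ 1 := by
  simp [inclLeft]

theorem coeff_inclRight (F : (Matrix m m R)⟦X⟧) (k : ℕ) (i j : m) :
    coeff k (inclRight F) i j = 1 ⊗ₜ coeff k F i j := by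
  simp [inclRight]

theorem mapCoeff_mul {d : R →ₗ[ℂ] R ⊗[ℂ] R}
    (hd : ∀ P Q, d (P * Q) = (P ⊗ₜ[ℂ] 1) * d Q + d P * (1 ⊗ₜ[ℂ] Q)) (F G : (Matrix m m R)⟦X⟧) :
    mapCoeff d (F * G) = inclLeft F * mapCoeff d G + mapCoeff d F * inclRight G := by
  ext k i j
  simp only [coeff_mapCoeff, coeff_mul, map_add, Matrix.map_apply, Matrix.sum_apply,
    Matrix.mul_apply, map_sum, hd, Matrix.add_apply, coeff_inclLeft, coeff_inclRight,
    Finset.sum_add_distrib]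

theorem mapCoeff_map_inclLeft_mul_inclRight (ψ : R →ₗ[ℂ] S) (F G : (Matrix m m R)⟦X⟧) :
    mapCoeff (TensorProduct.map ψ ψ) (inclLeft F * inclRight G) =
      inclLeft (mapCoeff ψ F) * inclRight (mapCoeff ψ G) := by
  ext k i j
  simp [coeff_mul, Matrix.sum_apply, Matrix.mul_apply, coeff_inclLeft, coeff_inclRight]

variable {d : R →ₗ[ℂ] R ⊗[ℂ] R} {d' : S →ₗ[ℂ] S ⊗[ℂ] S}

theorem map_one_of_leibniz
    (hd : ∀ P Q, d (P * Q) = (P ⊗ₜ[ℂ] 1) * d Q + d P * (1 ⊗ₜ[ℂ] Q)) : d 1 = 0 := by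
  have h := hd 1 1
  rw [← Algebra.TensorProduct.one_def, one_mul, mul_one, one_mul] at h
  simpa using h

/-- Formal resolvents are corepresentations. -/
theorem mapCoeff_formal_resolvent
    (hd : ∀ P Q, d (P * Q) = (P ⊗ₜ[ℂ] 1) * d Q + d P * (1 ⊗ₜ[ℂ] Q))
    {F p : (Matrix m m R)⟦X⟧} (hF : mapCoeff d F = X) (hFp : F * p = 1) (hpF : p * F = 1) :
    mapCoeff d p = -(X * (inclLeft p * inclRight p)) := by
  -- Apply `∂` to `F p = 1`, then cancel the left factor `F ⊗ 1`.
  have h1 := mapCoeff_mul hd F p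
  rw [hFp, mapCoeff_one (map_one_of_leibniz hd), hF] at h1
  have h2 : inclLeft p * inclLeft F = 1 := by rw [← map_mul, hpF, map_one]
  have h3 : inclLeft F * mapCoeff d p = -(X * inclRight p) := by
    rw [eq_neg_iff_add_eq_zero, ← h1]
  calc mapCoeff d p = inclLeft p * inclLeft F * mapCoeff d p := by rw [h2, one_mul]
    _ = _ := by
      rw [mul_assoc, h3, mul_neg, ← mul_assoc, ← mul_assoc, (commute_X (inclLeft p)).eq]

/-- Converse of `mapCoeff_formal_resolvent`: apply `∂` to `q g = 1`, substitute the equation for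
`∂q`, and cancel `q ⊗ 1` on the left. -/
theorem mapCoeff_inverse_of_corepresentation
    (hd : ∀ P Q, d (P * Q) = (P ⊗ₜ[ℂ] 1) * d Q + d P * (1 ⊗ₜ[ℂ] Q))
    {q g : (Matrix m m R)⟦X⟧} (hq : mapCoeff d q = -(X * (inclLeft q * inclRight q)))
    (hqg : q * g = 1) (hgq : g * q = 1) : mapCoeff d g = X := by
  have h1 := mapCoeff_mul hd q g
  have h4 : inclRight q * inclRight g = 1 := by rw [← map_mul, hqg, map_one]
  rw [hqg, mapCoeff_one (map_one_of_leibniz hd), hq, neg_mul, mul_assoc, mul_assoc, h4, mul_one]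
    at h1
  have h2 : inclLeft g * inclLeft q = 1 := by rw [← map_mul, hgq, map_one]
  have h3 : inclLeft q * mapCoeff d g = X * inclLeft q := by
    rw [← sub_eq_zero, sub_eq_add_neg, ← h1]
  calc mapCoeff d g = inclLeft g * inclLeft q * mapCoeff d g := by rw [h2, one_mul]
    _ = _ := by
      rw [mul_assoc, h3, ← (commute_X (inclLeft q)).eq, ← mul_assoc, h2, one_mul]

omit [Fintype m] in
theorem map_diagonal_eq_one {e : R →ₗ[ℂ] R ⊗[ℂ] R} {w : R} (hw : e w = 1 ⊗ₜ 1) :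
    (Matrix.diagonal fun _ : m => w).map e = 1 := by
  rw [Matrix.diagonal_map (map_zero e), hw, ← Algebra.TensorProduct.one_def]
  exact Matrix.diagonal_one

/-- The equation `∂p = -z p ⊗ p` involves only `∂` and tensors, so it passes through any linear map
intertwining the two difference quotients; multiplicativity of `ψ` is not needed. -/
theorem mapCoeff_map_formal_resolvent
    (hd : ∀ P Q, d (P * Q) = (P ⊗ₜ[ℂ] 1) * d Q + d P * (1 ⊗ₜ[ℂ] Q))
    {ψ : R →ₗ[ℂ] S} (hψ : TensorProduct.map ψ ψ ∘ₗ d = d' ∘ₗ ψ)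
    {y : R} (hy : d y = 1 ⊗ₜ 1) {b : Matrix m m R} (hb : b.map d = 0) {p : (Matrix m m R)⟦X⟧}
    (h1 : (X * C (Matrix.diagonal fun _ => y) - C b) * p = 1)
    (h2 : p * (X * C (Matrix.diagonal fun _ => y) - C b) = 1) :
    mapCoeff d' (mapCoeff ψ p) =
      -(X * (inclLeft (mapCoeff ψ p) * inclRight (mapCoeff ψ p))) := by
  have hF : mapCoeff d (X * C (Matrix.diagonal fun _ => y) - C b) = X := by
    rw [mapCoeff_sub, mapCoeff_X_mul, mapCoeff_C, mapCoeff_C, hb, map_diagonal_eq_one hy]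
    simp
  rw [← mapCoeff_map_inclLeft_mul_inclRight, ← mapCoeff_X_mul, ← mapCoeff_neg,
    ← mapCoeff_formal_resolvent hd hF h1 h2]
  ext k i j
  simpa using (LinearMap.congr_fun hψ (coeff k p i j)).symm

end FormalResolvent

/-! ### Inversion of lower triangular matrices -/

section Triangular

variable {R : Type*} [Ring R] {n : ℕ}

/-- The subring of lower triangular matrices. -/
def lowerTriangular (R : Type*) [Ring R] (n : ℕ) : Subring (Matrix (Fin n) (Fin n) R) where
  carrier := {M | ∀ i j, i < j → M i j = 0}
  mul_mem' {M N} hM hN i j hij := by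
    rw [Matrix.mul_apply]
    refine Finset.sum_eq_zero fun k _ => ?_
    rcases lt_or_ge i k with h | h
    · rw [hM i k h, zero_mul]
    · rw [hN k j (h.trans_lt hij), mul_zero]
  one_mem' i j hij := Matrix.one_apply_ne hij.ne
  add_mem' {M N} hM hN i j hij := by rw [Matrix.add_apply, hM i j hij, hN i j hij, add_zero]
  zero_mem' _ _ _ := rfl
  neg_mem' {M} hM i j hij := by rw [Matrix.neg_apply, hM i j hij, neg_zero]

theorem mem_lowerTriangular {M : Matrix (Fin n) (Fin n) R} :
    M ∈ lowerTriangular R n ↔ ∀ i j, i < j → M i j = 0 := Iff.rfl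

theorem mul_apply_diag_of_lowerTriangular {M N : Matrix (Fin n) (Fin n) R}
    (hM : M ∈ lowerTriangular R n) (hN : N ∈ lowerTriangular R n) (i : Fin n) :
    (M * N) i i = M i i * N i i := by
  rw [Matrix.mul_apply]
  refine Finset.sum_eq_single i (fun k _ hk => ?_) (by simp)
  rcases lt_or_gt_of_ne hk with h | h
  · rw [hN k i h, mul_zero]
  · rw [hM i k h, zero_mul]

/-- Each factor moves at least one step below the diagonal, so the `k`-th power lives at depth `k`
or more. -/
theorem pow_apply_eq_zero_of_strictlyLower {M : Matrix (Fin n) (Fin n) R}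
    (hM : ∀ i j, i ≤ j → M i j = 0) (k : ℕ) (i j : Fin n) (hij : (i : ℕ) < j + k) :
    (M ^ k) i j = 0 := by
  induction k generalizing i j with
  | zero =>
    rw [pow_zero]
    exact Matrix.one_apply_ne (Fin.ne_of_lt (by simpa using hij))
  | succ k ih =>
    rw [pow_succ, Matrix.mul_apply]
    refine Finset.sum_eq_zero fun l _ => ?_
    rcases le_or_gt l j with h | h
    · rw [hM l j h, mul_zero]
    · rw [ih i l (by have : (j : ℕ) < l := h; omega), zero_mul]

/-- Dividing by the diagonal part leaves `1 - S` with `S` strictly lower triangular, hence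
nilpotent. Working inside the subring `T` makes the inverse lower triangular for free. -/
theorem exists_inverse_lowerTriangular {M : Matrix (Fin n) (Fin n) R}
    (hM : M ∈ lowerTriangular R n) (hu : ∀ i, IsUnit (M i i)) :
    ∃ N ∈ lowerTriangular R n, M * N = 1 ∧ N * M = 1 := by
  set T := lowerTriangular R n
  have hdiag : ∀ v : Fin n → R, Matrix.diagonal v ∈ T := fun v i j hij =>
    Matrix.diagonal_apply_ne _ hij.ne
  let E : T := ⟨Matrix.diagonal fun i => Ring.inverse (M i i), hdiag _⟩
  let D : T := ⟨Matrix.diagonal fun i => M i i, hdiag _⟩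
  have hDE : D * E = 1 := Subtype.ext (by
    simp [D, E, Matrix.diagonal_mul_diagonal, Ring.mul_inverse_cancel _ (hu _)])
  have hED : E * D = 1 := Subtype.ext (by
    simp [D, E, Matrix.diagonal_mul_diagonal, Ring.inverse_mul_cancel _ (hu _)])
  let M' : T := ⟨M, hM⟩
  let S : T := 1 - E * M'
  have hS : IsNilpotent S := by
    refine ⟨n, Subtype.ext ?_⟩
    ext i j
    rw [SubmonoidClass.coe_pow]
    refine pow_apply_eq_zero_of_strictlyLower (fun i j hij => ?_) n i j (by omega)
    rcases hij.lt_or_eq with h | rfl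
    · exact S.2 i j h
    · simp [S, E, M', Ring.inverse_mul_cancel _ (hu _)]
  have hEM : IsUnit (E * M') := by
    have h := hS.isUnit_one_sub
    rwa [sub_sub_cancel] at h
  have hM' : IsUnit M' := by
    have h : M' = D * (E * M') := by rw [← mul_assoc, hDE, one_mul]
    rw [h]
    exact IsUnit.mul ⟨⟨D, E, hDE, hED⟩, rfl⟩ hEM
  obtain ⟨u, hu'⟩ := hM'
  refine ⟨(↑u⁻¹ : T), (↑u⁻¹ : T).2, ?_, ?_⟩
  · have := congrArg Subtype.val u.mul_inv
    rwa [hu'] at this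
  · have := congrArg Subtype.val u.inv_mul
    rwa [hu'] at this

theorem isUnit_of_lowerTriangular {M : Matrix (Fin n) (Fin n) R}
    (hM : M ∈ lowerTriangular R n) (hu : ∀ i, IsUnit (M i i)) : IsUnit M := by
  obtain ⟨N, -, h1, h2⟩ := exists_inverse_lowerTriangular hM hu
  exact ⟨⟨M, N, h1, h2⟩, rfl⟩

theorem inverse_mem_lowerTriangular {M : Matrix (Fin n) (Fin n) R}
    (hM : M ∈ lowerTriangular R n) (hu : ∀ i, IsUnit (M i i)) :
    Ring.inverse M ∈ lowerTriangular R n := by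
  obtain ⟨N, hN, h1, h2⟩ := exists_inverse_lowerTriangular hM hu
  have : Ring.inverse M = N := Ring.inverse_unit ⟨M, N, h1, h2⟩
  rwa [this]

theorem inverse_apply_diag_of_lowerTriangular {M : Matrix (Fin n) (Fin n) R}
    (hM : M ∈ lowerTriangular R n) (hu : ∀ i, IsUnit (M i i)) (i : Fin n) :
    Ring.inverse M i i = Ring.inverse (M i i) := by
  have h := mul_apply_diag_of_lowerTriangular hM (inverse_mem_lowerTriangular hM hu) i
  rw [Ring.mul_inverse_cancel _ (isUnit_of_lowerTriangular hM hu), Matrix.one_apply_eq] at h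
  rw [← one_mul (Ring.inverse M i i), ← Ring.inverse_mul_cancel _ (hu i), mul_assoc, ← h, mul_one]

end Triangular

/-! ### The upper half-plane of a C⋆-algebra -/

section UpperHalf

variable {K : Type*} [CStarAlgebra K] [PartialOrder K] [StarOrderedRing K]

omit [PartialOrder K] [StarOrderedRing K] in
theorem imaginaryPart_eq (T : K) : (imaginaryPart T : K) = (-Complex.I / 2) • (T - star T) := by
  rw [imaginaryPart_apply_coe, ← Complex.coe_smul, smul_smul]
  congr 1
  push_cast
  ring

omit [PartialOrder K] [StarOrderedRing K] in
theorem imaginaryPart_conj (V T : K) :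
    (imaginaryPart (V * T * star V) : K) = V * imaginaryPart T * star V := by
  simp [imaginaryPart_eq, mul_sub, sub_mul, mul_assoc]

theorem add_mem_upperHalf {X T : K} (hX : IsSelfAdjoint X) (hT : T ∈ upperHalf K) :
    X + T ∈ upperHalf K := by
  obtain ⟨ε, hε, h⟩ := hT
  refine ⟨ε, hε, ?_⟩
  rwa [map_add, hX.imaginaryPart, zero_add]

/-- `W = -iT` has real part at least `ε`, so `‖1 - sW‖ < 1` for a small `s > 0` and `sW` is
invertible by the Neumann series. -/
theorem isUnit_of_mem_upperHalf {T : K} (hT : T ∈ upperHalf K) : IsUnit T := by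
  obtain ⟨ε, hε, h⟩ := hT
  rcases subsingleton_or_nontrivial K with _ | _
  · exact isUnit_of_subsingleton _
  set W : K := (-Complex.I) • T with hW
  have hWre : algebraMap ℝ K (2 * ε) ≤ W + star W := by
    have h1 : W + star W = (2 : ℝ) • (imaginaryPart T : K) := by
      rw [imaginaryPart_eq, hW, ← Complex.coe_smul, smul_smul, star_smul]
      have : star (-Complex.I) = Complex.I := by simp
      rw [this, smul_sub]
      have h2 : ((2 : ℝ) : ℂ) * (-Complex.I / 2) = -Complex.I := by push_cast; ring
      rw [h2, neg_smul, neg_smul]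
      abel
    rw [h1, map_mul, Algebra.algebraMap_eq_smul_one 2, smul_mul_assoc, one_mul]
    exact smul_le_smul_of_nonneg_left h zero_le_two
  set c : ℝ := ‖W‖ ^ 2 + 1 with hc
  have hc0 : 0 < c := by positivity
  -- This choice minimises `1 - 2sε + s²c`, with minimum `1 - sε`.
  set s : ℝ := ε / c with hs
  have hs0 : 0 < s := by positivity
  have hWW : star W * W ≤ algebraMap ℝ K c := by
    have h1 := (IsSelfAdjoint.star_mul_self W).le_algebraMap_norm_self
    refine h1.trans ?_
    rw [CStarRing.norm_star_mul_self]
    apply algebraMap_mono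
    rw [hc]
    nlinarith
  have hle : star (1 - s • W) * (1 - s • W) ≤ algebraMap ℝ K (1 - s * ε) := by
    have e1 : star (1 - s • W) * (1 - s • W) =
        1 - s • (W + star W) + (s ^ 2) • (star W * W) := by
      simp only [star_sub, star_one, star_smul, star_trivial, sub_mul, mul_sub, one_mul, mul_one,
        smul_mul_smul_comm, smul_add, pow_two]
      abel
    have e2 : algebraMap ℝ K (1 - s * ε) =
        1 - s • algebraMap ℝ K (2 * ε) + (s ^ 2) • algebraMap ℝ K c := by
      have h1 : 1 - s * ε = 1 - s * (2 * ε) + s ^ 2 * c := by rw [hs]; field_simp; ring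
      rw [h1, map_add, map_sub, map_one, map_mul, map_mul _ (s ^ 2), Algebra.smul_def,
        Algebra.smul_def]
    rw [e1, e2]
    gcongr
  have hnorm : ‖1 - s • W‖ < 1 := by
    have h0 : max (1 - s * ε) 0 < 1 := max_lt (by nlinarith) one_pos
    have h1 := (CStarAlgebra.norm_le_iff_le_algebraMap _ (le_max_right (1 - s * ε) 0)
      (star_mul_self_nonneg (1 - s • W))).2 (hle.trans (algebraMap_mono K (le_max_left _ _)))
    rw [CStarRing.norm_star_mul_self] at h1
    nlinarith [norm_nonneg (1 - s • W)]
  have hu : IsUnit (s • W) := by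
    have := isUnit_one_sub_of_norm_lt_one hnorm
    rwa [sub_sub_cancel] at this
  rw [hW, ← Complex.coe_smul, smul_smul] at hu
  have hs1 : IsUnit ((s : ℂ) * -Complex.I) := by simp [hs0.ne']
  exact (isUnit_smul_iff hs1.unit T).1 hu

/-- With `V = T⁻¹`, `-V = V(-T⋆)V⋆`, so its imaginary part is `V (Im T) V⋆ ≥ ε VV⋆`, and `VV⋆ ≥ 1/c`
follows from `TT⋆ ≤ c`. -/
theorem neg_inverse_mem_upperHalf {T : K} (hT : T ∈ upperHalf K) :
    -Ring.inverse T ∈ upperHalf K := by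
  have hu := isUnit_of_mem_upperHalf hT
  obtain ⟨ε, hε, h⟩ := hT
  set V := Ring.inverse T
  have hVT : V * T = 1 := Ring.inverse_mul_cancel _ hu
  set c : ℝ := ‖T‖ ^ 2 + 1 with hc
  have hc0 : 0 < c := by positivity
  have e1 : -V = V * (-star T) * star V := by
    rw [mul_neg, neg_mul, mul_assoc, ← star_mul, hVT, star_one, mul_one]
  have e2 : (imaginaryPart (-star T) : K) = imaginaryPart T := by
    simp [imaginaryPart_eq, add_comm, sub_eq_add_neg]
  refine ⟨ε / c, by positivity, ?_⟩
  rw [e1, imaginaryPart_conj, e2]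
  have h1 : algebraMap ℝ K ε * (V * star V) ≤ V * imaginaryPart T * star V := by
    have := star_right_conjugate_le_conjugate h V
    rwa [← Algebra.commutes, mul_assoc] at this
  refine le_trans ?_ h1
  have h2 : T * star T ≤ algebraMap ℝ K c := by
    have h1 := (IsSelfAdjoint.mul_star_self T).le_algebraMap_norm_self
    refine h1.trans ?_
    rw [CStarRing.norm_self_mul_star]
    apply algebraMap_mono
    rw [hc]
    nlinarith
  have h3 : 1 ≤ algebraMap ℝ K c * (V * star V) := by
    have := star_right_conjugate_le_conjugate h2 V
    rw [← Algebra.commutes, mul_assoc V, mul_assoc T, ← star_mul, hVT, star_one,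
      mul_one, hVT, mul_assoc] at this
    exact this
  have h4 := smul_le_smul_of_nonneg_left h3 (show 0 ≤ ε / c by positivity)
  rw [← Algebra.algebraMap_eq_smul_one] at h4
  refine h4.trans_eq ?_
  rw [Algebra.algebraMap_eq_smul_one, Algebra.algebraMap_eq_smul_one, smul_mul_assoc,
    smul_mul_assoc, smul_smul, div_mul_cancel₀ _ hc0.ne']

theorem isOpen_upperHalf : IsOpen (upperHalf K) := by
  rw [Metric.isOpen_iff]
  rintro T ⟨ε, hε, h⟩
  refine ⟨ε / 2, by positivity, fun T' hT' => ⟨ε / 2, by positivity, ?_⟩⟩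
  set J : selfAdjoint K := imaginaryPart (T' - T)
  have h1 := J.2.neg_algebraMap_norm_le_self
  have h2 : ‖(J : K)‖ ≤ ε / 2 := (imaginaryPart.norm_le _).trans (mem_ball_iff_norm.1 hT').le
  have h3 : (imaginaryPart T' : K) = imaginaryPart T + J := by
    simp [J]
  have h4 : algebraMap ℝ K (ε / 2) = algebraMap ℝ K ε + - algebraMap ℝ K (ε / 2) := by
    rw [← map_neg, ← map_add]
    congr 1
    ring
  rw [h3, h4]
  refine add_le_add h (le_trans ?_ h1)
  exact neg_le_neg (algebraMap_mono K h2)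

variable {L : Type*} [CStarAlgebra L] [PartialOrder L] [StarOrderedRing L]

theorem map_mem_upperHalf (Ψ : L →ₚ[ℂ] K) (hΨ1 : Ψ 1 = 1) {T : L} (hT : T ∈ upperHalf L) :
    Ψ T ∈ upperHalf K := by
  obtain ⟨ε, hε, h⟩ := hT
  refine ⟨ε, hε, ?_⟩
  have h1 : (imaginaryPart (Ψ T) : K) = Ψ (imaginaryPart T : L) := by
    rw [imaginaryPart_eq, imaginaryPart_eq, map_smul, map_sub, map_star]
  rw [h1]
  have h2 := OrderHomClass.mono Ψ h
  rwa [Algebra.algebraMap_eq_smul_one, ← Complex.coe_smul, map_smul, hΨ1, Complex.coe_smul,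
    ← Algebra.algebraMap_eq_smul_one] at h2

end UpperHalf

/-! ### Taylor series of Banach-algebra-valued curves and the identity theorem -/

section Taylor

open PowerSeries
open scoped Nat

variable {𝔸 𝔹 : Type*} [NormedRing 𝔸] [NormedAlgebra ℝ 𝔸] [NormedRing 𝔹] [NormedAlgebra ℝ 𝔹]

/-- The Taylor series at `0` of a function of a real variable. -/
def taylorSeries (f : ℝ → 𝔸) : 𝔸⟦X⟧ := PowerSeries.mk fun k => (k ! : ℝ)⁻¹ • iteratedDeriv k f 0

theorem coeff_taylorSeries (f : ℝ → 𝔸) (k : ℕ) :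
    coeff k (taylorSeries f) = (k ! : ℝ)⁻¹ • iteratedDeriv k f 0 := by
  simp [taylorSeries]

theorem iteratedDeriv_eq_coeff_taylorSeries (f : ℝ → 𝔸) (k : ℕ) :
    iteratedDeriv k f 0 = (k ! : ℝ) • coeff k (taylorSeries f) := by
  rw [coeff_taylorSeries, smul_inv_smul₀ (by positivity)]

theorem taylorSeries_const (a : 𝔸) : taylorSeries (fun _ => a) = C a := by
  ext k
  rw [coeff_taylorSeries, coeff_C, iteratedDeriv_const]
  split_ifs with h
  · simp [h]
  · simp

theorem taylorSeries_smul_const (a : 𝔸) : taylorSeries (fun z : ℝ => z • a) = X * C a := by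
  have hd : deriv (fun z : ℝ => z • a) = fun _ => a := by
    ext z
    simpa using ((hasDerivAt_id z).smul_const a).deriv
  ext k
  rw [coeff_taylorSeries]
  cases k with
  | zero => simp
  | succ k =>
    rw [iteratedDeriv_succ', hd, coeff_succ_X_mul, iteratedDeriv_const, coeff_C]
    split_ifs with h
    · simp [h]
    · simp

variable [CompleteSpace 𝔸]

theorem taylorSeries_mul {f g : ℝ → 𝔸} (hf : AnalyticAt ℝ f 0) (hg : AnalyticAt ℝ g 0) :
    taylorSeries (f * g) = taylorSeries f * taylorSeries g := by
  ext k
  rw [coeff_taylorSeries, coeff_mul, iteratedDeriv_mul hf.contDiffAt hg.contDiffAt,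
    Finset.Nat.sum_antidiagonal_eq_sum_range_succ_mk, Finset.smul_sum]
  refine Finset.sum_congr rfl fun i hi => ?_
  have hik : i ≤ k := Nat.lt_succ_iff.1 (Finset.mem_range.1 hi)
  rw [coeff_taylorSeries, coeff_taylorSeries, smul_mul_smul_comm, mul_assoc, ← nsmul_eq_mul,
    ← Nat.cast_smul_eq_nsmul ℝ, smul_smul, Nat.cast_choose ℝ hik]
  congr 1
  field_simp

theorem taylorSeries_sub {f g : ℝ → 𝔸} (hf : AnalyticAt ℝ f 0) (hg : AnalyticAt ℝ g 0) :
    taylorSeries (f - g) = taylorSeries f - taylorSeries g := by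
  ext k
  rw [map_sub, coeff_taylorSeries, coeff_taylorSeries, coeff_taylorSeries,
    iteratedDeriv_sub hf.contDiffAt hg.contDiffAt, smul_sub]

theorem coeff_taylorSeries_comp (ℓ : 𝔸 →L[ℝ] 𝔹) {f : ℝ → 𝔸} (hf : AnalyticAt ℝ f 0) (k : ℕ) :
    coeff k (taylorSeries fun z => ℓ (f z)) = ℓ (coeff k (taylorSeries f)) := by
  rw [coeff_taylorSeries, coeff_taylorSeries, map_smul, iteratedDeriv, iteratedDeriv,
    show (fun z => ℓ (f z)) = ℓ ∘ f from rfl,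
    ℓ.iteratedFDeriv_comp_left hf.contDiffAt (i := k) (n := k) le_rfl]
  rfl

theorem taylorSeries_inverse {f : ℝ → 𝔸} (hf : AnalyticAt ℝ f 0)
    (hu : ∀ z, IsUnit (f z)) :
    taylorSeries f * taylorSeries (fun z => Ring.inverse (f z)) = 1 ∧
      taylorSeries (fun z => Ring.inverse (f z)) * taylorSeries f = 1 := by
  have hi : AnalyticAt ℝ (fun z => Ring.inverse (f z)) 0 := by
    obtain ⟨u, hu'⟩ := hu 0
    exact AnalyticAt.comp (g := Ring.inverse) (hu' ▸ analyticAt_inverse u) hf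
  rw [← taylorSeries_mul hf hi, ← taylorSeries_mul hi hf]
  have e1 : (f * fun z => Ring.inverse (f z)) = fun _ => 1 :=
    funext fun z => Ring.mul_inverse_cancel _ (hu z)
  have e2 : (fun z => Ring.inverse (f z)) * f = fun _ => 1 :=
    funext fun z => Ring.inverse_mul_cancel _ (hu z)
  rw [e1, e2, taylorSeries_const, map_one]
  exact ⟨rfl, rfl⟩

/-- A real-analytic curve whose Taylor coefficients at `0` lie in a closed subspace stays in it. -/
theorem mem_of_iteratedDeriv_mem {E : Type*} [NormedAddCommGroup E] [NormedSpace ℝ E]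
    [CompleteSpace E] {N : Submodule ℝ E} (hN : IsClosed (N : Set E)) {f : ℝ → E}
    (hf : AnalyticOnNhd ℝ f Set.univ) (h : ∀ k, iteratedDeriv k f 0 ∈ N) (z : ℝ) : f z ∈ N := by
  -- As `N` is closed, the quotient is a normed space, and the claim becomes the usual identity
  -- theorem for `ℓ ∘ f`.
  set ℓ : E →L[ℝ] E ⧸ N := N.mkQL
  have hℓ : ∀ x, ℓ x = 0 ↔ x ∈ N := fun x => Submodule.Quotient.mk_eq_zero N
  have hℓf : AnalyticOnNhd ℝ (fun z => ℓ (f z)) Set.univ := fun w hw =>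
    (ℓ.analyticAt _).comp (hf w hw)
  have h0 : ∀ k, iteratedDeriv k (fun z => ℓ (f z)) 0 = 0 := fun k => by
    rw [iteratedDeriv, show (fun z => ℓ (f z)) = ℓ ∘ f from rfl,
      ℓ.iteratedFDeriv_comp_left (hf 0 trivial).contDiffAt (i := k) (n := k) le_rfl]
    exact (hℓ _).2 (h k)
  have h1 : ∀ᶠ w in nhds 0, ℓ (f w) = 0 := by
    rw [← analyticOrderAt_eq_top, ENat.eq_top_iff_forall_ge]
    intro k
    rw [natCast_le_analyticOrderAt_iff_iteratedDeriv_eq_zero (hℓf 0 trivial)]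
    exact fun i _ => h0 i
  exact (hℓ _).1 (hℓf.eqOn_zero_of_preconnected_of_eventuallyEq_zero isPreconnected_univ
    (Set.mem_univ 0) h1 (Set.mem_univ z))

end Taylor

/-! ### Descent of differentiability along isometries -/

section Holomorphy

/-- The range of `ι` is closed because `V` is complete. Modulo the range the map is zero, so its
derivative takes values there and can be pulled back. -/
theorem LinearIsometry.differentiableAt_of_comp {V W F : Type*} [NormedAddCommGroup V]
    [NormedSpace ℂ V] [CompleteSpace V] [NormedAddCommGroup W] [NormedSpace ℂ W]
    [NormedAddCommGroup F] [NormedSpace ℂ F] (ι : V →ₗᵢ[ℂ] F) {Φ : W → V} {x : W}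
    (h : DifferentiableAt ℂ (fun w => ι (Φ w)) x) : DifferentiableAt ℂ Φ x := by
  obtain ⟨f', hf'⟩ := h
  set N : Submodule ℂ F := ι.toLinearMap.range
  have hN : IsClosed (N : Set F) := by
    have := ι.isometry.isClosedEmbedding.isClosed_range
    rwa [LinearMap.coe_range]
  have hmem : ∀ w, f' w ∈ N := by
    have h1 := (N.mkQL.hasFDerivAt (x := ι (Φ x))).comp x hf'
    have h2 : (N.mkQL ∘ fun w => ι (Φ w)) = fun _ => 0 := by
      ext w
      exact (Submodule.Quotient.mk_eq_zero N).2 ⟨Φ w, rfl⟩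
    rw [h2] at h1
    have h3 := h1.unique (hasFDerivAt_const (0 : F ⧸ N) x)
    intro w
    exact (Submodule.Quotient.mk_eq_zero N).1 (DFunLike.congr_fun h3 w)
  choose g hg using hmem
  let G : W →L[ℂ] V := LinearMap.mkContinuous
    { toFun := g
      map_add' := fun a b => ι.injective (by
        have := hg (a + b)
        simp only [LinearIsometry.coe_toLinearMap] at this hg
        rw [this, map_add, map_add, hg, hg])
      map_smul' := fun c a => ι.injective (by
        have := hg (c • a)
        simp only [LinearIsometry.coe_toLinearMap] at this hg
        rw [this, map_smul, RingHom.id_apply, map_smul, hg]) } ‖f'‖ (fun w => by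
      change ‖g w‖ ≤ _
      rw [← ι.norm_map (g w)]
      exact (congrArg norm (hg w)).trans_le (f'.le_opNorm w))
  refine ⟨G, ?_⟩
  rw [hasFDerivAt_iff_isLittleO] at hf' ⊢
  refine Asymptotics.IsLittleO.congr_left (f₁ := fun w => Φ w - Φ x - G (w - x)) ?_
    (fun _ => rfl)
  rw [← Asymptotics.isLittleO_norm_left] at hf' ⊢
  refine hf'.congr_left fun w => ?_
  rw [← ι.norm_map]
  congr 1
  rw [map_sub ι, map_sub ι]
  exact congrArg₂ _ rfl (hg _).symm

end Holomorphy

/-! ### Triangular half-planes and the subordination map -/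

section TriangularHalf

variable {K L : Type*} [CStarAlgebra K] [PartialOrder K] [StarOrderedRing K]
  [CStarAlgebra L] [PartialOrder L] [StarOrderedRing L] {n : ℕ}

/-- `Δ₊M_n(K)` for the whole C⋆-algebra `K`. -/
def triangularHalf (K : Type*) [CStarAlgebra K] [PartialOrder K] [StarOrderedRing K] (n : ℕ) :
    Set (Matrix (Fin n) (Fin n) K) :=
  {M | M ∈ lowerTriangular K n ∧ ∀ i, M i i ∈ upperHalf K}

theorem mem_deltaPlus_iff {A : StarSubalgebra ℂ K} {κ : Matrix (Fin n) (Fin n) A} :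
    κ ∈ deltaPlus A n ↔ κ.map (fun a => (a : K)) ∈ triangularHalf K n := by
  simp [deltaPlus, triangularHalf, mem_lowerTriangular]

theorem isUnit_of_mem_triangularHalf {M : Matrix (Fin n) (Fin n) K}
    (hM : M ∈ triangularHalf K n) : IsUnit M :=
  isUnit_of_lowerTriangular hM.1 fun i => isUnit_of_mem_upperHalf (hM.2 i)

theorem neg_inverse_mem_triangularHalf {M : Matrix (Fin n) (Fin n) K}
    (hM : M ∈ triangularHalf K n) : -Ring.inverse M ∈ triangularHalf K n := by
  have hu := fun i => isUnit_of_mem_upperHalf (hM.2 i)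
  refine ⟨neg_mem (inverse_mem_lowerTriangular hM.1 hu), fun i => ?_⟩
  rw [Matrix.neg_apply, inverse_apply_diag_of_lowerTriangular hM.1 hu]
  exact neg_inverse_mem_upperHalf (hM.2 i)

theorem diagonal_add_mem_triangularHalf {X : K} (hX : IsSelfAdjoint X)
    {M : Matrix (Fin n) (Fin n) K} (hM : M ∈ triangularHalf K n) :
    Matrix.diagonal (fun _ => X) + M ∈ triangularHalf K n := by
  refine ⟨add_mem (fun i j hij => Matrix.diagonal_apply_ne _ hij.ne) hM.1, fun i => ?_⟩
  rw [Matrix.add_apply, Matrix.diagonal_apply_eq]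
  exact add_mem_upperHalf hX (hM.2 i)

theorem map_mem_triangularHalf (Ψ : L →ₚ[ℂ] K) (hΨ1 : Ψ 1 = 1) {M : Matrix (Fin n) (Fin n) L}
    (hM : M ∈ triangularHalf L n) : M.map Ψ ∈ triangularHalf K n :=
  ⟨fun i j hij => by rw [Matrix.map_apply, hM.1 i j hij, map_zero],
    fun i => map_mem_upperHalf Ψ hΨ1 (hM.2 i)⟩

theorem ring_inverse_neg {R : Type*} [Ring R] (a : R) :
    Ring.inverse (-a) = -Ring.inverse a := by
  by_cases h : IsUnit a
  · obtain ⟨u, rfl⟩ := h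
    rw [← Units.val_neg, Ring.inverse_unit, Ring.inverse_unit, inv_neg, Units.val_neg]
  · rw [Ring.inverse_non_unit _ h, Ring.inverse_non_unit _ (by rwa [IsUnit.neg_iff]), neg_zero]

theorem isUnit_diagonal_sub {X : K} (hX : IsSelfAdjoint X) {M : Matrix (Fin n) (Fin n) K}
    (hM : M ∈ triangularHalf K n) : IsUnit (Matrix.diagonal (fun _ => X) - M) := by
  have h := isUnit_of_mem_triangularHalf (diagonal_add_mem_triangularHalf hX.neg hM)
  rw [← IsUnit.neg_iff, neg_sub, sub_eq_neg_add, Matrix.diagonal_neg]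
  exact h

/-- `(X - M)⁻¹ = -(-X + M)⁻¹`, and `-X + M` stays in the half-plane. -/
theorem inverse_diagonal_sub_mem {X : K} (hX : IsSelfAdjoint X) {M : Matrix (Fin n) (Fin n) K}
    (hM : M ∈ triangularHalf K n) :
    Ring.inverse (Matrix.diagonal (fun _ => X) - M) ∈ triangularHalf K n := by
  have h := neg_inverse_mem_triangularHalf (diagonal_add_mem_triangularHalf hX.neg hM)
  rw [← ring_inverse_neg, neg_add, Matrix.diagonal_neg] at h
  simpa [sub_eq_add_neg] using h

/-- The map `β ↦ X ⊗ I - (M_n(Ψ)((Y ⊗ I - β)⁻¹))⁻¹`. -/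
def subordination (X : K) (Y : L) (Ψ : L →ₚ[ℂ] K) (M : Matrix (Fin n) (Fin n) L) :
    Matrix (Fin n) (Fin n) K :=
  Matrix.diagonal (fun _ => X) -
    Ring.inverse ((Ring.inverse (Matrix.diagonal (fun _ => Y) - M)).map Ψ)

theorem subordination_mem {X : K} (hX : IsSelfAdjoint X) {Y : L} (hY : IsSelfAdjoint Y)
    {Ψ : L →ₚ[ℂ] K} (hΨ1 : Ψ 1 = 1) {M : Matrix (Fin n) (Fin n) L}
    (hM : M ∈ triangularHalf L n) : subordination X Y Ψ M ∈ triangularHalf K n := by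
  rw [subordination, sub_eq_add_neg]
  exact diagonal_add_mem_triangularHalf hX (neg_inverse_mem_triangularHalf
    (map_mem_triangularHalf Ψ hΨ1 (inverse_diagonal_sub_mem hY hM)))

end TriangularHalf

/-! ### Holomorphy of the subordination map into `M_n(K)` -/

section MatrixCalculus

attribute [local instance] Matrix.linftyOpNormedRing Matrix.linftyOpNormedAlgebra

variable {K L : Type*} [CStarAlgebra K] [PartialOrder K] [StarOrderedRing K]
  [CStarAlgebra L] [PartialOrder L] [StarOrderedRing L] {n : ℕ}

omit [PartialOrder K] [StarOrderedRing K] in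
theorem completeSpace_matrix : 
    @CompleteSpace (Matrix (Fin n) (Fin n) K) PseudoMetricSpace.toUniformSpace :=
  inferInstanceAs (CompleteSpace (Fin n → Fin n → K))

/-- The entrywise action of a positive map on matrices, as a continuous linear map. -/
def matrixMapL (n : ℕ) (Ψ : L →ₚ[ℂ] K) :
    Matrix (Fin n) (Fin n) L →L[ℂ] Matrix (Fin n) (Fin n) K where
  toLinearMap := Ψ.toLinearMap.mapMatrix
  cont := by
    have h : Continuous Ψ := map_continuous Ψ
    exact continuous_id.matrix_map h

theorem differentiableAt_subordination {X : K} {Y : L} (hY : IsSelfAdjoint Y)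
    {Ψ : L →ₚ[ℂ] K} (hΨ1 : Ψ 1 = 1) {M : Matrix (Fin n) (Fin n) L}
    (hM : M ∈ triangularHalf L n) :
    DifferentiableAt ℂ (subordination X Y Ψ : _ → Matrix (Fin n) (Fin n) K) M := by
  have := completeSpace_matrix (K := K) (n := n)
  have := completeSpace_matrix (K := L) (n := n)
  have h1 : DifferentiableAt ℂ (fun M : Matrix (Fin n) (Fin n) L =>
      Ring.inverse (Matrix.diagonal (fun _ => Y) - M)) M :=
    DifferentiableAt.comp (g := Ring.inverse) M
      (differentiableAt_inverse (isUnit_diagonal_sub hY hM))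
      (differentiableAt_id.const_sub _)
  have h2 : DifferentiableAt ℂ (fun M : Matrix (Fin n) (Fin n) L =>
      (Ring.inverse (Matrix.diagonal (fun _ => Y) - M)).map Ψ) M :=
    DifferentiableAt.comp (g := matrixMapL n Ψ) M (matrixMapL n Ψ).differentiableAt h1
  have h3 := isUnit_of_mem_triangularHalf
    (map_mem_triangularHalf Ψ hΨ1 (inverse_diagonal_sub_mem hY hM))
  exact (DifferentiableAt.comp (g := Ring.inverse) M (differentiableAt_inverse h3)
    h2).const_sub _

end MatrixCalculus

/-! ### The subordination map has entries in `A` -/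

section Entries

open PowerSeries

attribute [local instance] Matrix.linftyOpNormedRing Matrix.linftyOpNormedAlgebra

/-- The inclusion `A → A⟨X⟩`. -/
def genAlgIncl {K : Type*} [CStarAlgebra K] (A : StarSubalgebra ℂ K) (X : K) :
    A →ₐ[ℂ] genAlg A X :=
  (evalAt A X).rangeRestrict.comp NCPoly.C

theorem coe_genAlgIncl {K : Type*} [CStarAlgebra K] (A : StarSubalgebra ℂ K) (X : K) (a : A) :
    (genAlgIncl A X a : K) = a := NCPoly.lift_C _ _ _

theorem freeDiffQuot_genAlgIncl {K : Type*} [CStarAlgebra K] {A : StarSubalgebra ℂ K} {X : K}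
    (h : AlgFree A X) (a : A) : freeDiffQuot h (genAlgIncl A X a) = 0 := by
  have h1 := (genAlgIncl A X a).2
  rw [coe_genAlgIncl] at h1
  rw [← freeDiffQuot_coe h a a.2 h1]
  exact congrArg _ (Subtype.ext (coe_genAlgIncl A X a))

theorem self_mem_genAlg {K : Type*} [CStarAlgebra K] (A : StarSubalgebra ℂ K) (X : K) :
    X ∈ genAlg A X := ⟨NCPoly.t, NCPoly.lift_t _ _⟩

variable {K L : Type*} [CStarAlgebra K] [PartialOrder K] [StarOrderedRing K]
  [CStarAlgebra L] [PartialOrder L] [StarOrderedRing L] {n : ℕ}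

omit [PartialOrder K] [StarOrderedRing K] in
theorem isClosed_matrixOver {A : StarSubalgebra ℂ K} (hA : IsClosed (A : Set K)) :
    IsClosed {M : Matrix (Fin n) (Fin n) K | ∀ i j, M i j ∈ A} := by
  simp only [Set.ofPred_forall]
  exact isClosed_iInter fun i => isClosed_iInter fun j =>
    hA.preimage (continuous_id.matrix_elem i j)

/-- Matrices over `K` with entries in `A`. -/
def matrixOver (A : StarSubalgebra ℂ K) (n : ℕ) : Submodule ℝ (Matrix (Fin n) (Fin n) K) where
  carrier := {M | ∀ i j, M i j ∈ A}
  add_mem' hM hN i j := add_mem (hM i j) (hN i j)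
  zero_mem' _ _ := zero_mem A
  smul_mem' c M hM i j := by
    rw [Matrix.smul_apply, ← Complex.coe_smul]
    exact A.smul_mem (hM i j) _

/-- Spectral permanence: diagonal entries invertible in `K` are invertible in the closed
⋆-subalgebra `A`. -/
theorem isUnit_of_coe_mem_triangularHalf {A : StarSubalgebra ℂ K} (hA : IsClosed (A : Set K))
    {M : Matrix (Fin n) (Fin n) A} (hM : M.map (fun a => (a : K)) ∈ triangularHalf K n) :
    IsUnit M := by
  have : IsClosed (A : Set K) := hA
  refine isUnit_of_lowerTriangular (fun i j hij => Subtype.ext (hM.1 i j hij)) fun i => ?_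
  exact A.coe_isUnit.1 (isUnit_of_mem_upperHalf (hM.2 i))

/-- The inverse of the formal pencil `z Y - β`, as a power series in `z`. -/
theorem exists_formal_resolvent {B : StarSubalgebra ℂ L} (hB : IsClosed (B : Set L)) (Y : L)
    {β : Matrix (Fin n) (Fin n) B} (hβ : β ∈ deltaPlus B n) :
    ∃ p : (Matrix (Fin n) (Fin n) (genAlg B Y))⟦X⟧,
      (X * C (Matrix.diagonal fun _ => (⟨Y, self_mem_genAlg B Y⟩ : genAlg B Y)) -
        C (β.map (genAlgIncl B Y))) * p = 1 ∧
      p * (X * C (Matrix.diagonal fun _ => (⟨Y, self_mem_genAlg B Y⟩ : genAlg B Y)) -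
        C (β.map (genAlgIncl B Y))) = 1 := by
  -- A power series is invertible once its constant term is. Here that term is `-β`, already
  -- invertible over `B`, so no inverse outside `B⟨Y⟩` is required.
  have h1 : IsUnit (β.map (genAlgIncl B Y)) :=
    (isUnit_of_coe_mem_triangularHalf hB (mem_deltaPlus_iff.1 hβ)).map
      (genAlgIncl B Y).mapMatrix
  have h2 : IsUnit (X * C (Matrix.diagonal fun _ => (⟨Y, self_mem_genAlg B Y⟩ : genAlg B Y)) -
      C (β.map (genAlgIncl B Y))) := by
    rw [PowerSeries.isUnit_iff_constantCoeff]
    simpa using h1.neg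
  obtain ⟨u, hu⟩ := h2
  exact ⟨(↑u⁻¹ : _), by rw [← hu, u.mul_inv], by rw [← hu, u.inv_mul]⟩

omit [PartialOrder L] [StarOrderedRing L] in
theorem analyticAt_pencil (Y : L) (M : Matrix (Fin n) (Fin n) L) (z : ℝ) :
    AnalyticAt ℝ (fun z : ℝ => z • Matrix.diagonal (fun _ => Y) - M) z :=
  (analyticAt_id.smul analyticAt_const).sub analyticAt_const

theorem subordination_apply_mem {A : StarSubalgebra ℂ K} (hA : IsClosed (A : Set K))
    {B : StarSubalgebra ℂ L} (hB : IsClosed (B : Set L))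
    {x : K} (hxA : AlgFree A x) {y : L} (hy : IsSelfAdjoint y) (hyB : AlgFree B y)
    {Ψ : L →ₚ[ℂ] K} (hΨ1 : Ψ 1 = 1) {ψ : genAlg B y →ₗ[ℂ] genAlg A x}
    (hψ : ∀ P, (ψ P : K) = Ψ P)
    (hcomul : TensorProduct.map ψ ψ ∘ₗ freeDiffQuot hyB = freeDiffQuot hxA ∘ₗ ψ)
    {β : Matrix (Fin n) (Fin n) B} (hβ : β ∈ deltaPlus B n) (i j : Fin n) :
    subordination x y Ψ (β.map fun b => (b : L)) i j ∈ A := by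
  have := completeSpace_matrix (K := K) (n := n)
  have := completeSpace_matrix (K := L) (n := n)
  set βL : Matrix (Fin n) (Fin n) L := β.map fun b => (b : L) with hβL
  have hβ' : βL ∈ triangularHalf L n := mem_deltaPlus_iff.1 hβ
  -- The parameter is kept real so that `z • y` is self-adjoint and `M z` is invertible for every
  -- `z`.
  let M : ℝ → Matrix (Fin n) (Fin n) L := fun z => z • Matrix.diagonal (fun _ => y) - βL
  have hMz : ∀ z, M z = Matrix.diagonal (fun _ => z • y) - βL := fun z => by
    simp only [M]
    rw [← Matrix.diagonal_smul]
    rfl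
  have hzy : ∀ z : ℝ, IsSelfAdjoint (z • y) := fun z => (IsSelfAdjoint.all z).smul hy
  have hMu : ∀ z, IsUnit (M z) := fun z => hMz z ▸ isUnit_diagonal_sub (hzy z) hβ'
  let κ : ℝ → Matrix (Fin n) (Fin n) K := fun z => (Ring.inverse (M z)).map Ψ
  have hκ : ∀ z, κ z ∈ triangularHalf K n := fun z =>
    map_mem_triangularHalf Ψ hΨ1 (hMz z ▸ inverse_diagonal_sub_mem (hzy z) hβ')
  have hκu : ∀ z, IsUnit (κ z) := fun z => isUnit_of_mem_triangularHalf (hκ z)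
  let f : ℝ → Matrix (Fin n) (Fin n) K := fun z =>
    z • Matrix.diagonal (fun _ => x) - Ring.inverse (κ z)
  have hMan : ∀ z, AnalyticAt ℝ M z := analyticAt_pencil y βL
  have hMian : ∀ z, AnalyticAt ℝ (fun z => Ring.inverse (M z)) z := fun z => by
    obtain ⟨u, hu⟩ := hMu z
    exact AnalyticAt.comp (g := Ring.inverse) (hu ▸ analyticAt_inverse u) (hMan z)
  let Ψn : Matrix (Fin n) (Fin n) L →L[ℝ] Matrix (Fin n) (Fin n) K :=
    (matrixMapL n Ψ).restrictScalars ℝ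
  have hκan : ∀ z, AnalyticAt ℝ κ z := fun z =>
    AnalyticAt.comp (g := Ψn) (Ψn.analyticAt _) (hMian z)
  have hκian : ∀ z, AnalyticAt ℝ (fun z => Ring.inverse (κ z)) z := fun z => by
    obtain ⟨u, hu⟩ := hκu z
    exact AnalyticAt.comp (g := Ring.inverse) (hu ▸ analyticAt_inverse u) (hκan z)
  have hsan : ∀ z, AnalyticAt ℝ
      (fun z : ℝ => z • Matrix.diagonal (fun _ : Fin n => x)) z := fun z =>
    analyticAt_id.smul analyticAt_const
  have hfan : AnalyticOnNhd ℝ f Set.univ := fun z _ => (hsan z).sub (hκian z)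
  obtain ⟨p, hp1, hp2⟩ := exists_formal_resolvent hB y hβ
  have hdβ : (β.map (genAlgIncl B y)).map (freeDiffQuot hyB) = 0 := by
    ext i j
    exact freeDiffQuot_genAlgIncl hyB (β i j)
  have hq := mapCoeff_map_formal_resolvent (freeDiffQuot_mul hyB) hcomul
    (freeDiffQuot_self hyB _) hdβ hp1 hp2
  set q := mapCoeff ψ p
  let ιL : (Matrix (Fin n) (Fin n) (genAlg B y))⟦X⟧ →+* (Matrix (Fin n) (Fin n) L)⟦X⟧ :=
    PowerSeries.map (genAlg B y).val.mapMatrix.toRingHom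
  let ιK : (Matrix (Fin n) (Fin n) (genAlg A x))⟦X⟧ →+* (Matrix (Fin n) (Fin n) K)⟦X⟧ :=
    PowerSeries.map (genAlg A x).val.mapMatrix.toRingHom
  have hTM : taylorSeries M = ιL (X * C (Matrix.diagonal fun _ =>
      (⟨y, self_mem_genAlg B y⟩ : genAlg B y)) - C (β.map (genAlgIncl B y))) := by
    have h1 := taylorSeries_sub (f := fun z : ℝ => z • Matrix.diagonal (fun _ : Fin n => y))
      (g := fun _ => βL) (analyticAt_id.smul analyticAt_const) analyticAt_const
    rw [taylorSeries_smul_const, taylorSeries_const] at h1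
    refine h1.trans ?_
    rw [map_sub, map_mul, PowerSeries.map_X, PowerSeries.map_C, PowerSeries.map_C]
    congr 3
    · ext i j
      simp [Matrix.diagonal_apply]
      split_ifs <;> rfl
    · ext i j
      exact (coe_genAlgIncl B y _).symm
  -- Both series invert the Taylor series of `M`, so they agree; this links the analytic and formal
  -- resolvents.
  have hTMi : taylorSeries (fun z => Ring.inverse (M z)) = ιL p := by
    have h1 := (taylorSeries_inverse (hMan 0) hMu).2
    refine left_inv_eq_right_inv h1 ?_
    rw [hTM, ← map_mul, hp1, map_one]
  have hTκ : taylorSeries κ = ιK q := by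
    ext1 k
    have h1 := coeff_taylorSeries_comp Ψn (hMian 0) k
    refine h1.trans ?_
    rw [hTMi]
    ext i j
    change Ψ (coeff k (ιL p) i j) = coeff k (ιK q) i j
    simp only [ιL, ιK, q, PowerSeries.coeff_map, coeff_mapCoeff]
    exact (hψ _).symm
  have hmemA : ∀ (F : (Matrix (Fin n) (Fin n) (genAlg A x))⟦X⟧) (k : ℕ),
      coeff k (mapCoeff (freeDiffQuot hxA) F) = 0 → ∀ i j, (coeff k F i j : K) ∈ A := by
    intro F k h i j
    refine mem_of_freeDiffQuot_eq_zero hxA ?_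
    rw [coeff_mapCoeff] at h
    exact congrFun (congrFun h i) j
  -- The right side of `hq` has no constant term, so `∂q₀ = 0` and `q₀` has entries in `A`. It
  -- equals `κ 0`, which lies in the half-plane, so it is invertible over `A` and a fortiori over
  -- `A⟨X⟩`.
  have hqu : IsUnit q := by
    rw [PowerSeries.isUnit_iff_constantCoeff]
    have h0 := hmemA q 0 (by rw [hq]; simp)
    let a : Matrix (Fin n) (Fin n) A := fun i j => ⟨_, h0 i j⟩
    have hκ0 : a.map (fun a => (a : K)) = κ 0 := by
      have h1 : coeff 0 (taylorSeries κ) = κ 0 := by simp [coeff_taylorSeries]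
      rw [← h1, hTκ]
      ext i j
      simp [ιK, a]
      rfl
    have ha : IsUnit a := isUnit_of_coe_mem_triangularHalf hA (hκ0 ▸ hκ 0)
    have h2 := ha.map (genAlgIncl A x).mapMatrix
    rw [← coeff_zero_eq_constantCoeff_apply]
    convert! h2 using 1
    ext i j
    exact (coe_genAlgIncl A x (a i j)).symm
  obtain ⟨u, hu⟩ := hqu
  set g : (Matrix (Fin n) (Fin n) (genAlg A x))⟦X⟧ := ↑u⁻¹
  have hqg : q * g = 1 := by rw [← hu, u.mul_inv]
  have hgq : g * q = 1 := by rw [← hu, u.inv_mul]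
  have hdg := mapCoeff_inverse_of_corepresentation (freeDiffQuot_mul hxA) hq hqg hgq
  have hTκi : taylorSeries (fun z => Ring.inverse (κ z)) = ιK g := by
    have h1 := (taylorSeries_inverse (hκan 0) hκu).2
    refine left_inv_eq_right_inv h1 ?_
    rw [hTκ, ← map_mul, hqg, map_one]
  set h : (Matrix (Fin n) (Fin n) (genAlg A x))⟦X⟧ :=
    X * C (Matrix.diagonal fun _ => (⟨x, self_mem_genAlg A x⟩ : genAlg A x)) - g
  -- Both `zX` and `g` have difference quotient `z`.
  have hdh : mapCoeff (freeDiffQuot hxA) h = 0 := by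
    rw [mapCoeff_sub, mapCoeff_X_mul, mapCoeff_C, hdg,
      map_diagonal_eq_one (freeDiffQuot_self hxA _), map_one, mul_one, sub_self]
  have hTf : taylorSeries f = ιK h := by
    have h1 := taylorSeries_sub (hsan 0) (hκian 0)
    rw [taylorSeries_smul_const, hTκi] at h1
    refine h1.trans ?_
    rw [map_sub, map_mul, PowerSeries.map_X, PowerSeries.map_C]
    congr 3
    ext i j
    simp [Matrix.diagonal_apply]
    split_ifs <;> rfl
  have hf1 : f 1 ∈ matrixOver A n := by
    refine mem_of_iteratedDeriv_mem (isClosed_matrixOver hA) hfan (fun k => ?_) 1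
    rw [iteratedDeriv_eq_coeff_taylorSeries, hTf]
    refine Submodule.smul_mem _ _ fun i j => ?_
    have h1 := hmemA h k (by rw [hdh]; rfl) i j
    simpa [ιK] using h1
  have h2 := hf1 i j
  simpa [f, κ, M, subordination] using h2

end Entries

/-! ### Holomorphy with values in `M_n(A)` -/

section Differentiability

attribute [local instance] Matrix.linftyOpNormedRing Matrix.linftyOpNormedAlgebra

variable {K L : Type*} [CStarAlgebra K] [PartialOrder K] [StarOrderedRing K]
  [CStarAlgebra L] [PartialOrder L] [StarOrderedRing L] {n : ℕ}

/-- The inclusion of a subalgebra, as a linear isometry. -/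
def subalgebraIsometry (A : StarSubalgebra ℂ K) : A →ₗᵢ[ℂ] K where
  toLinearMap := A.toSubalgebra.val.toLinearMap
  norm_map' _ := rfl

/-- The projection of `M_n(B)` onto the lower triangular matrices, with values in `M_n(L)`. -/
def lowerPart (B : StarSubalgebra ℂ L) (n : ℕ) :
    Matrix (Fin n) (Fin n) B →L[ℂ] Matrix (Fin n) (Fin n) L where
  toFun β := Matrix.of fun i j => if i < j then 0 else (β i j : L)
  map_add' β γ := by
    ext i j
    simp only [Matrix.add_apply, Matrix.of_apply]
    split_ifs <;> simp
  map_smul' c β := by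
    ext i j
    simp only [Matrix.smul_apply, Matrix.of_apply]
    split_ifs <;> simp
  cont := by
    refine continuous_matrix fun i j => ?_
    simp only [Matrix.of_apply]
    split_ifs
    · exact continuous_const
    · exact continuous_subtype_val.comp (continuous_id.matrix_elem i j)

theorem lowerPart_eq {B : StarSubalgebra ℂ L} {β : Matrix (Fin n) (Fin n) B}
    (hβ : β ∈ deltaPlus B n) : lowerPart B n β = β.map fun b => (b : L) := by
  ext i j
  change (if i < j then 0 else (β i j : L)) = β i j
  split_ifs with h
  · rw [hβ.1 i j h]
    rfl
  · rfl

/-- `deltaPlus` need not be open among all matrices. Composing with `lowerPart` extends the map to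
the open set given by the diagonal condition alone, without new values. -/
theorem exists_lowerPart_eq (B : StarSubalgebra ℂ L) (β : Matrix (Fin n) (Fin n) B)
    (hβ : ∀ i, (β i i : L) ∈ upperHalf L) :
    ∃ γ ∈ deltaPlus B n, lowerPart B n β = γ.map fun b => (b : L) := by
  refine ⟨fun i j => if i < j then 0 else β i j, ⟨fun i j hij => if_pos hij, fun i => ?_⟩, ?_⟩
  · simpa using hβ i
  · ext i j
    change (if i < j then 0 else (β i j : L)) = ((if i < j then 0 else β i j : B) : L)
    split_ifs <;> rfl

theorem isOpen_diagonal_mem_upperHalf (B : StarSubalgebra ℂ L) :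
    IsOpen {β : Matrix (Fin n) (Fin n) B | ∀ i, (β i i : L) ∈ upperHalf L} := by
  simp only [Set.ofPred_forall]
  exact isOpen_iInter_of_finite fun i => isOpen_upperHalf.preimage
    (continuous_subtype_val.comp (continuous_id.matrix_elem i i))

open Classical in
/-- A map into `M_n(K)`, viewed as a map into `M_n(A)` where its entries lie in `A`. -/
def restrictEntries {W : Type*} (A : StarSubalgebra ℂ K) (H : W → Matrix (Fin n) (Fin n) K)
    (w : W) : Matrix (Fin n) (Fin n) A :=
  fun i j => if h : H w i j ∈ A then ⟨H w i j, h⟩ else 0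

omit [PartialOrder K] [StarOrderedRing K] in
theorem coe_restrictEntries {W : Type*} {A : StarSubalgebra ℂ K}
    {H : W → Matrix (Fin n) (Fin n) K} {w : W} {i j : Fin n} (h : H w i j ∈ A) :
    (restrictEntries A H w i j : K) = H w i j := by
  rw [restrictEntries, dif_pos h]

omit [PartialOrder K] [StarOrderedRing K] in
theorem differentiableAt_restrictEntries {W : Type*} [NormedAddCommGroup W] [NormedSpace ℂ W]
    {A : StarSubalgebra ℂ K} (hA : IsClosed (A : Set K)) {H : W → Matrix (Fin n) (Fin n) K} {w : W}
    (hH : DifferentiableAt ℂ H w) (hmem : ∀ᶠ v in nhds w, ∀ i j, H v i j ∈ A) :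
    DifferentiableAt ℂ (restrictEntries A H) w := by
  have : CompleteSpace A := hA.completeSpace_coe
  change DifferentiableAt ℂ (restrictEntries A H : W → Fin n → Fin n → A) w
  refine differentiableAt_pi.2 fun i => differentiableAt_pi.2 fun j => ?_
  refine (subalgebraIsometry A).differentiableAt_of_comp ?_
  have h1 : DifferentiableAt ℂ (fun v => H v i j) w :=
    differentiableAt_pi.1 (differentiableAt_pi.1
      (show DifferentiableAt ℂ (H : W → Fin n → Fin n → K) w from hH) i) j
  refine h1.congr_of_eventuallyEq ?_
  filter_upwards [hmem] with v hv
  exact coe_restrictEntries (hv i j)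

end Differentiability

end

/-- The topology on `M_n(B)` is the entrywise one, i.e. that of its C⋆-norm. `Δ₊M_n(B)` is open in
the closed complemented subspace of lower triangular matrices, so differentiability within it is
complex Fréchet differentiability on an open subset of that Banach space. -/
theorem mainTheorem7 {K : Type*} {L : Type*}
    [CStarAlgebra K] [PartialOrder K] [StarOrderedRing K]
    [CStarAlgebra L] [PartialOrder L] [StarOrderedRing L]
    (A : StarSubalgebra ℂ K) (hA : IsClosed (A : Set K))
    (B : StarSubalgebra ℂ L) (hB : IsClosed (B : Set L))
    (X : K) (hX : IsSelfAdjoint X) (hXA : AlgFree A X)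
    (Y : L) (hY : IsSelfAdjoint Y) (hYB : AlgFree B Y)
    (Ψ : CompletelyPositiveMap L K) (hΨ1 : Ψ 1 = 1)
    (hΨ : ∀ P ∈ (genAlg B Y).toSubmodule, Ψ.toLinearMap P ∈ (genAlg A X).toSubmodule)
    (hcomul : TensorProduct.map (Ψ.toLinearMap.restrict hΨ) (Ψ.toLinearMap.restrict hΨ) ∘ₗ
        freeDiffQuot hYB = freeDiffQuot hXA ∘ₗ Ψ.toLinearMap.restrict hΨ)
    (hXcl : ClosableDiffQuot hXA) (hYcl : ClosableDiffQuot hYB) (n : ℕ) :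
    ∃ Φ : Matrix (Fin n) (Fin n) B → Matrix (Fin n) (Fin n) A,
      Set.MapsTo Φ (deltaPlus B n) (deltaPlus A n) ∧
      DifferentiableOn ℂ Φ (deltaPlus B n) ∧
      ∀ β ∈ deltaPlus B n,
        IsUnit (Matrix.diagonal (fun _ => Y) - β.map (fun b => (b : L))) ∧
        IsUnit (Matrix.diagonal (fun _ => X) - (Φ β).map (fun a => (a : K))) ∧
        (Ring.inverse (Matrix.diagonal (fun _ => Y) - β.map (fun b => (b : L)))).map Ψ =
          Ring.inverse (Matrix.diagonal (fun _ => X) - (Φ β).map (fun a => (a : K))) := by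
  let _ := Matrix.linftyOpNormedRing (n := Fin n) (α := B)
  let _ := Matrix.linftyOpNormedAlgebra (n := Fin n) (R := ℂ) (α := B)
  let _ := Matrix.linftyOpNormedRing (n := Fin n) (α := K)
  let _ := Matrix.linftyOpNormedAlgebra (n := Fin n) (R := ℂ) (α := K)
  let _ := Matrix.linftyOpNormedRing (n := Fin n) (α := L)
  let _ := Matrix.linftyOpNormedAlgebra (n := Fin n) (R := ℂ) (α := L)
  let Ψp : L →ₚ[ℂ] K := .ofClass Ψ
  have hΨp1 : Ψp 1 = 1 := hΨ1
  let ψ : genAlg B Y →ₗ[ℂ] genAlg A X := Ψ.toLinearMap.restrict hΨ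
  have hψ : ∀ P, (ψ P : K) = Ψp P := fun _ => rfl
  have hentries : ∀ γ ∈ deltaPlus B n, ∀ i j,
      subordination X Y Ψp (γ.map fun b => (b : L)) i j ∈ A := fun γ hγ =>
    subordination_apply_mem hA hB hXA hY hYB hΨp1 hψ hcomul hγ
  -- Thanks to `lowerPart`, `H` is differentiable at points of `deltaPlus` in the full matrix space,
  -- and its entries stay in `A` on a neighbourhood of each.
  let H : Matrix (Fin n) (Fin n) B → Matrix (Fin n) (Fin n) K := fun β =>
    subordination X Y Ψp (lowerPart B n β)
  have hcoe : ∀ β ∈ deltaPlus B n, (restrictEntries A H β).map (fun a => (a : K)) =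
      subordination X Y Ψp (β.map fun b => (b : L)) := by
    intro β hβ
    have h : H β = subordination X Y Ψp (β.map fun b => (b : L)) := by
      simp only [H, lowerPart_eq hβ]
    ext i j
    rw [Matrix.map_apply, coe_restrictEntries (h ▸ hentries β hβ i j), h]
  refine ⟨restrictEntries A H, fun β hβ => ?_, fun β hβ => ?_, fun β hβ => ?_⟩
  · rw [mem_deltaPlus_iff, hcoe β hβ]
    exact subordination_mem hX hY hΨp1 (mem_deltaPlus_iff.1 hβ)
  · refine (differentiableAt_restrictEntries hA (DifferentiableAt.comp
      (g := subordination X Y Ψp) β ?_ (lowerPart B n).differentiableAt)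
      ?_).differentiableWithinAt
    · rw [lowerPart_eq hβ]
      exact differentiableAt_subordination hY hΨp1 (mem_deltaPlus_iff.1 hβ)
    · filter_upwards [(isOpen_diagonal_mem_upperHalf B).mem_nhds hβ.2] with γ hγ
      obtain ⟨γ', hγ', h⟩ := exists_lowerPart_eq B γ hγ
      simp only [Function.comp_apply, h]
      exact hentries γ' hγ'
  · have hβ' := mem_deltaPlus_iff.1 hβ
    have hu := isUnit_of_mem_triangularHalf
      (map_mem_triangularHalf Ψp hΨp1 (inverse_diagonal_sub_mem hY hβ'))
    have h1 : Matrix.diagonal (fun _ => X) - (restrictEntries A H β).map (fun a => (a : K)) =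
        Ring.inverse ((Ring.inverse (Matrix.diagonal (fun _ => Y) -
          β.map fun b => (b : L))).map Ψp) := by
      rw [hcoe β hβ, subordination, sub_sub_cancel]
    refine ⟨isUnit_diagonal_sub hY hβ', ?_, ?_⟩
    · rw [h1]
      exact hu.ringInverse
    · rw [h1, Ring.inverse_inverse hu]
      rfl
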